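/- **Setting.** Let $E$ be the set of all measures $\varphi$ on $\mathbb R$ with values in $\{0,1,2,\dots,\infty\}$ that are finite on bounded Borel sets, with the $\sigma$-field $\mathcal E$ generated by the maps $\varphi\mapsto\varphi(B)$, $B$ Borel. Let $M=\{\varphi\in E:\varphi(\mathbb R)>0,\ \varphi\{y\}\le 1\text{ for all }y\}$ and $M^\infty=\{\varphi\in M:\varphi(-\infty,0]=\varphi(0,\infty)=\infty\}$, with trace $\sigma$-fields $\mathcal M=M\cap\mathcal E$ and $\mathcal M^\infty=M^\infty\cap\mathcal M$. The atoms of $\varphi\in M$ are denoted $\cdots<T_{-1}<T_0\le 0<T_1<T_2<\cdots$ (as far as they are finite), $\alpha_n=T_{n+1}-T_n$, and $F_n=\{\varphi\in M:|T_n(\varphi)|<\infty\}$. The time-shifts are $\theta_y\varphi=\varphi(y+\cdot)$ ($y\in\mathbb R$), the event-shifts are $\eta_n\varphi=\varphi(T_n(\varphi)+\cdot)$ for $\varphi\in F_n$ ($n\in\mathbb Z$), and $\eta_n^{-1}A=\{\varphi\in F_n:\eta_n\varphi\in A\}$. Further, $N(B)=\sum_{n\in\mathbb Z}1_{[T_n\in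 B]}$, $N_A(B)=\sum_{n\in\mathbb Z}1_{[T_n\in B]}\,1_A\circ\eta_n$, and $\mathcal I=\{A\in\mathcal M^\infty:\eta_1^{-1}A=A\}$ is the invariant $\sigma$-field on $M^\infty$. Let $P$ be a probability measure on $(E,\mathcal E)$ with $P(M^\infty)=1$. $P$ is **TAMS** if there is a probability measure $P_{ts}$ on $(M,\mathcal M)$ with $$\frac1x\int_0^x P[\theta_y\varphi\in A]\,dy\to P_{ts}(A)\quad(x\to\infty)\qquad\text{for all }A\in\mathcal M .$$ $P$ is **EAMS** with limit distribution $P_{es}$, where $P_{es}$ is a probability measure on $(M^\infty,\mathcal M^\infty)$, if $$\frac1n\sum_{i=1}^n P[\eta_i\varphi\in A]\to P_{es}(A)\quad(n\to\infty)\qquad\text{for all }A\in\mathcal M^\infty ;$$ $P$ is EAMS if such a $P_{es}$ exists. **Theorem 4.3.** Let $\Phi$ be a point process (a random element of $E$) with distribution $P$ such that $P(M^\infty)=1$. In the statements below, convergence means convergence to a finite limit. (a) $P$ is EAMS if and only if, for every $A\in\mathcal M^\infty$, $\frac1n\sum_{i=1}^n 1_A\circ\eta_i$ converges $P$-a.s.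 as $n\to\infty$. (b) $P$ is EAMS with a limit distribution $P_{es}$ such that $P_{es}\bigl[0<E_{es}(\alpha_0\mid\mathcal I)<\infty\bigr]=1$ if and only if, for every $A\in\mathcal M^\infty$, $\frac1x N_A(0,x]$ converges $P$-a.s. as $x\to\infty$, and the limit of $\frac1x N(0,x]$ belongs $P$-a.s. to $(0,\infty)$. Here $E_{es}(\alpha_0\mid\mathcal I)\in[0,\infty]$ is the conditional expectation under $P_{es}$ of the nonnegative variable $\alpha_0$, which need not be integrable. (c) $P$ is TAMS if and only if, for every $A\in\mathcal M^\infty$, $\frac1x\int_0^x 1_A\circ\theta_y\,dy$ converges $P$-a.s. as $x\to\infty$. -/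

import Mathlib

open MeasureTheory Filter Set Topology
open scoped ENNReal

noncomputable section

namespace PointProcess

/-- Integer-valued (i.e. `{0, 1, 2, …, ∞}`-valued) measures on `ℝ` that are finite on bounded
Borel sets. -/
def IsCountingMeasure (φ : Measure ℝ) : Prop :=
  (∀ B : Set ℝ, MeasurableSet B → ∃ k : ℕ∞, φ B = (k : ℝ≥0∞)) ∧
    ∀ B : Set ℝ, MeasurableSet B → Bornology.IsBounded B → φ B < ∞

/-- The space `E` of integer-valued, locally finite measures on `ℝ`. Its σ-field `𝓔` (the
subtype instance) is generated by the evaluations `φ ↦ φ B`, `B` Borel. -/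
abbrev E : Type := {φ : Measure ℝ // IsCountingMeasure φ}

/-- `M`: the nonzero elements of `E` with single occurrences only. -/
def M : Set E := {φ | 0 < φ.1 univ ∧ ∀ y : ℝ, φ.1 {y} ≤ 1}

/-- `M^∞`: the elements of `M` with infinitely many points in both half-lines. -/
def Minf : Set E := {φ | φ ∈ M ∧ φ.1 (Iic 0) = ∞ ∧ φ.1 (Ioi 0) = ∞}

theorem map_sub_apply (φ : Measure ℝ) (y : ℝ) {B : Set ℝ} (hB : MeasurableSet B) :
    φ.map (fun t => t - y) B = φ ((fun t => t - y) ⁻¹' B) :=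
  Measure.map_apply (by fun_prop) hB

theorem isCountingMeasure_shift {φ : Measure ℝ} (h : IsCountingMeasure φ) (y : ℝ) :
    IsCountingMeasure (φ.map (fun t => t - y)) := by
  refine ⟨fun B hB => ?_, fun B hB hb => ?_⟩
  · rw [map_sub_apply φ y hB]
    exact h.1 _ (hB.preimage (by fun_prop))
  · rw [map_sub_apply φ y hB]
    refine h.2 _ (hB.preimage (by fun_prop)) ?_
    obtain ⟨r, hr⟩ := hb.subset_closedBall 0
    refine (Metric.isBounded_closedBall (x := (0 : ℝ)) (r := r + |y|)).subset ?_
    intro t ht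
    have h1 := hr ht
    simp only [Metric.mem_closedBall, dist_zero_right, Real.norm_eq_abs] at h1 ⊢
    have h2 := abs_add_le (t - y) y
    simp only [sub_add_cancel] at h2
    linarith

/-- The time-shift `θ_y φ = φ(y + ·)`, the image of `φ` under `t ↦ t - y`. -/
def θ (y : ℝ) (φ : E) : E := ⟨φ.1.map (fun t => t - y), isCountingMeasure_shift φ.2 y⟩

/-- The points `⋯ < T₋₁ < T₀ ≤ 0 < T₁ < T₂ < ⋯` of `φ`. For `n ≥ 1`, `T n φ` is the least `t > 0`
such that `(0, t]` contains at least `n` points (`⊤` if there is none); for `n ≤ 0`, it is the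
largest `t ≤ 0` such that `[t, 0]` contains at least `1 - n` points (`⊥` if there is none). -/
def T (n : ℤ) (φ : E) : EReal :=
  if 0 < n then
    sInf ((fun t : ℝ => (t : EReal)) '' {t : ℝ | 0 < t ∧ (n.toNat : ℝ≥0∞) ≤ φ.1 (Ioc 0 t)})
  else
    sSup ((fun t : ℝ => (t : EReal)) '' {t : ℝ | t ≤ 0 ∧ ((1 - n).toNat : ℝ≥0∞) ≤ φ.1 (Icc t 0)})

/-- `F_n = {φ ∈ M : |T_n φ| < ∞}`. -/
def F (n : ℤ) : Set E := {φ | φ ∈ M ∧ T n φ ≠ ⊥ ∧ T n φ ≠ ⊤}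

/-- The event-shift `η_n φ = φ(T_n φ + ·)`; only used for `φ ∈ F n`. -/
def η (n : ℤ) (φ : E) : E := θ (T n φ).toReal φ

/-- `θ_y⁻¹ A`. -/
def θInv (y : ℝ) (A : Set E) : Set E := {φ | θ y φ ∈ A}

/-- `η_n⁻¹ A = {φ ∈ F_n : η_n φ ∈ A}`. -/
def ηInv (n : ℤ) (A : Set E) : Set E := {φ | φ ∈ F n ∧ η n φ ∈ A}

/-- The interval length `α_n = T_{n+1} - T_n` between finite occurrences. -/
def α (n : ℤ) (φ : E) : ℝ := (T (n + 1) φ).toReal - (T n φ).toReal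

/-- `N(B)`: the number of occurrences in `B`. -/
def N (B : Set ℝ) (φ : E) : ℝ≥0∞ :=
  ∑' n : ℤ, {ψ : E | ψ ∈ F n ∧ (T n ψ).toReal ∈ B}.indicator 1 φ

/-- `N_A(B)`: the number of `A`-occurrences in `B`, i.e. of the occurrences `T_n ∈ B` with
`η_n φ ∈ A`. -/
def NA (A : Set E) (B : Set ℝ) (φ : E) : ℝ≥0∞ :=
  ∑' n : ℤ, {ψ : E | ψ ∈ F n ∧ (T n ψ).toReal ∈ B ∧ ψ ∈ ηInv n A}.indicator 1 φ

theorem measure_Iic_eq_top {φ : E} {a b : ℝ} (h : φ.1 (Iic a) = ∞) : φ.1 (Iic b) = ∞ := by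
  by_contra hb
  have h1 : φ.1 (Icc b a) < ∞ := φ.2.2 _ measurableSet_Icc (Metric.isBounded_Icc b a)
  have h2 : φ.1 (Iic a) ≤ φ.1 (Iic b) + φ.1 (Icc b a) := by
    refine (measure_mono ?_).trans (measure_union_le _ _)
    intro t ht
    rcases le_total t b with h | h
    · exact Or.inl h
    · exact Or.inr ⟨h, ht⟩
  rw [h, top_le_iff, ENNReal.add_eq_top] at h2
  exact h2.elim hb h1.ne

theorem measure_Ioi_eq_top {φ : E} {a b : ℝ} (h : φ.1 (Ioi a) = ∞) : φ.1 (Ioi b) = ∞ := by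
  by_contra hb
  have h1 : φ.1 (Icc a b) < ∞ := φ.2.2 _ measurableSet_Icc (Metric.isBounded_Icc a b)
  have h2 : φ.1 (Ioi a) ≤ φ.1 (Ioi b) + φ.1 (Icc a b) := by
    refine (measure_mono ?_).trans (measure_union_le _ _)
    intro t ht
    rcases lt_or_ge b t with h | h
    · exact Or.inl h
    · exact Or.inr ⟨le_of_lt ht, h⟩
  rw [h, top_le_iff, ENNReal.add_eq_top] at h2
  exact h2.elim hb h1.ne

theorem θ_mem_Minf {φ : E} (h : φ ∈ Minf) (y : ℝ) : θ y φ ∈ Minf := by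
  obtain ⟨⟨h0, h1⟩, h2, h3⟩ := h
  refine ⟨⟨?_, fun z => ?_⟩, ?_, ?_⟩
  · simp only [θ, map_sub_apply _ _ MeasurableSet.univ, preimage_univ]
    exact h0
  · simp only [θ, map_sub_apply _ _ (measurableSet_singleton z)]
    have : (fun t : ℝ => t - y) ⁻¹' {z} = {z + y} := by
      ext t; simp [sub_eq_iff_eq_add]
    rw [this]
    exact h1 _
  · simp only [θ, map_sub_apply _ _ measurableSet_Iic]
    have : (fun t : ℝ => t - y) ⁻¹' Iic 0 = Iic y := by ext t; simp
    rw [this]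
    exact measure_Iic_eq_top h2
  · simp only [θ, map_sub_apply _ _ measurableSet_Ioi]
    have : (fun t : ℝ => t - y) ⁻¹' Ioi 0 = Ioi y := by ext t; simp
    rw [this]
    exact measure_Ioi_eq_top h3

theorem θ_neg_θ (y : ℝ) (φ : E) : θ (-y) (θ y φ) = φ := by
  apply Subtype.ext
  simp only [θ]
  rw [Measure.map_map (by fun_prop) (by fun_prop)]
  have : ((fun t : ℝ => t - -y) ∘ fun t : ℝ => t - y) = id := by
    funext t; simp
  rw [this, Measure.map_id]

theorem mem_F_one_of_mem_Minf {φ : E} (h : φ ∈ Minf) : φ ∈ F 1 := by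
  refine ⟨h.1, ?_, ?_⟩
  · have : (0 : EReal) ≤ T 1 φ := by
      simp only [T, zero_lt_one, if_true]
      refine le_sInf ?_
      rintro _ ⟨t, ht, rfl⟩
      exact EReal.coe_nonneg.2 ht.1.le
    intro hb
    rw [hb] at this
    simp at this
  · obtain ⟨n, hn⟩ : ∃ n : ℕ, φ.1 (Ioc 0 (n : ℝ)) ≠ 0 := by
      by_contra hc
      push Not at hc
      have h0 : φ.1 (⋃ n : ℕ, Ioc 0 (n : ℝ)) = 0 := measure_iUnion_null hc
      have h1 : Ioi (0 : ℝ) ⊆ ⋃ n : ℕ, Ioc 0 (n : ℝ) := by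
        intro t ht
        obtain ⟨n, hn⟩ := exists_nat_ge t
        exact mem_iUnion.2 ⟨n, ht, hn⟩
      have h2 := measure_mono_null h1 h0
      rw [h.2.2] at h2
      exact ENNReal.top_ne_zero h2
    have hle : (1 : ℝ≥0∞) ≤ φ.1 (Ioc 0 (n : ℝ)) := by
      obtain ⟨k, hk⟩ := φ.2.1 (Ioc 0 (n : ℝ)) measurableSet_Ioc
      rw [hk] at hn ⊢
      have : k ≠ 0 := by
        rintro rfl
        simp at hn
      exact_mod_cast Order.one_le_iff_ne_zero.2 this
    have hpos : (0 : ℝ) < n := by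
      by_contra hc
      rw [Ioc_eq_empty hc, measure_empty] at hn
      exact hn rfl
    have : T 1 φ ≤ ((n : ℝ) : EReal) := by
      simp only [T, zero_lt_one, if_true]
      exact sInf_le ⟨(n : ℝ), ⟨hpos, by simpa using hle⟩, rfl⟩
    exact (this.trans_lt (EReal.coe_lt_top _)).ne

/-- The invariant σ-field `𝓘 = {A ∈ 𝓜^∞ : η₁⁻¹ A = A}` on `M^∞`. -/
@[reducible] def invariantField : MeasurableSpace Minf where
  MeasurableSet' A := MeasurableSet A ∧ ηInv 1 (Subtype.val '' A) = Subtype.val '' A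
  measurableSet_empty := ⟨MeasurableSet.empty, by simp [ηInv]⟩
  measurableSet_compl := by
    rintro A ⟨hA, hinv⟩
    refine ⟨hA.compl, ?_⟩
    have key : ∀ φ : E, φ ∈ F 1 → (η 1 φ ∈ Subtype.val '' A ↔ φ ∈ Subtype.val '' A) := by
      intro φ hφ
      constructor
      · intro h
        rw [← hinv]
        exact ⟨hφ, h⟩
      · intro h
        rw [← hinv] at h
        exact h.2
    ext φ
    constructor
    · rintro ⟨hF, ⟨ψ, hψ, hη⟩⟩
      have hm : φ ∈ Minf := by
        have h1 := θ_mem_Minf ψ.2 (-(T 1 φ).toReal)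
        rw [hη, η, θ_neg_θ] at h1
        exact h1
      refine ⟨⟨φ, hm⟩, fun hA' => ?_, rfl⟩
      obtain ⟨χ, hχ, hχη⟩ := (key φ hF).2 ⟨_, hA', rfl⟩
      exact hψ (Subtype.ext (hη.trans hχη.symm) ▸ hχ)
    · rintro ⟨ψ, hψ, rfl⟩
      have hF := mem_F_one_of_mem_Minf ψ.2
      refine ⟨hF, ⟨⟨η 1 ψ.1, θ_mem_Minf ψ.2 _⟩, fun hA' => ?_, rfl⟩⟩
      obtain ⟨χ, hχ, hχψ⟩ := (key ψ.1 hF).1 ⟨_, hA', rfl⟩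
      exact hψ (Subtype.ext hχψ ▸ hχ)
  measurableSet_iUnion := by
    intro f hf
    refine ⟨MeasurableSet.iUnion fun i => (hf i).1, ?_⟩
    rw [image_iUnion]
    conv_rhs => rw [← iUnion_congr fun i => (hf i).2]
    ext φ
    simp only [ηInv, mem_iUnion, mem_ofPred_eq]
    constructor
    · rintro ⟨h, i, hi⟩
      exact ⟨i, h, hi⟩
    · rintro ⟨i, h, hi⟩
      exact ⟨h, i, hi⟩

/-- `P` is TAMS(`Pts`): `Pts` is a probability distribution on `(M, 𝓜)` and
`(1/x) ∫₀ˣ P[θ_y φ ∈ A] dy → Pts(A)` as `x → ∞`, for all `A ∈ 𝓜`. -/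
def IsTAMSWith (P : Measure E) (Pts : Measure M) : Prop :=
  IsProbabilityMeasure Pts ∧ ∀ A : Set E, MeasurableSet A → A ⊆ M →
    Tendsto (fun x : ℝ => (1 / x) * ∫ y in (0 : ℝ)..x, P.real (θInv y A)) atTop
      (𝓝 (Pts.real (Subtype.val ⁻¹' A)))

/-- `P` is time-asymptotically mean stationary. -/
def IsTAMS (P : Measure E) : Prop := ∃ Pts : Measure M, IsTAMSWith P Pts

/-- `P` is EAMS(`Pes`): `P(M^∞) = 1`, `Pes` is a probability distribution on `(M^∞, 𝓜^∞)` and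
`(1/n) ∑_{i=1}^n P[η_i φ ∈ A] → Pes(A)` as `n → ∞`, for all `A ∈ 𝓜^∞`. -/
def IsEAMSWith (P : Measure E) (Pes : Measure Minf) : Prop :=
  P Minf = 1 ∧ IsProbabilityMeasure Pes ∧ ∀ A : Set E, MeasurableSet A → A ⊆ Minf →
    Tendsto (fun n : ℕ => (1 / (n : ℝ)) * ∑ i ∈ Finset.Icc 1 n, P.real (ηInv (i : ℤ) A)) atTop
      (𝓝 (Pes.real (Subtype.val ⁻¹' A)))

/-- `P` is event-asymptotically mean stationary. -/
def IsEAMS (P : Measure E) : Prop := ∃ Pes : Measure Minf, IsEAMSWith P Pes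

/-- `E_es(α₀ | 𝓘)`, the conditional expectation of the nonnegative variable `α₀` given `𝓘` under
`Pes`, with values in `[0, ∞]` (no integrability of `α₀` is required). -/
def condMeanGap (Pes : Measure Minf) : Minf → ℝ≥0∞ :=
  condLExp invariantField Pes (fun φ => ENNReal.ofReal (α 0 φ.1))

end PointProcess

end

/-!
Part (a) is the characterisation of asymptotically mean stationary measures by almost sure
convergence of ergodic averages (`exists_isAMSWith_iff`), applied to the event-shift `S = η 1` on
`M^∞`, whose iterates are `S^[n] = η n` for `n ≥ 1`. If the averaged laws converge setwise to `Q`,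
then `Q` is `S`-invariant, and `Q` agrees with `P` on strictly invariant events. The set where the
averages of an indicator converge is such an event and has `Q`-measure one by Birkhoff's theorem,
so it has `P`-measure one. Conversely, almost sure convergence gives setwise convergence of the
averaged laws by dominated convergence, and a setwise limit of probability measures is a
probability measure by Nikodym's convergence theorem. Birkhoff's theorem is derived from the maximal
ergodic theorem, applied on the invariant sets on which Birkhoff sums are unbounded; Nikodym's
theorem is derived from the Baire category theorem on the Cantor space of subsets of `ℕ`.

Part (c) is the same argument for the flow `θ y` in place of `S` (`exists_isFlowAMSWith_iff`):
time averages of an indicator are, along the integers, Birkhoff averages for `θ 1` of the bounded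
function `φ ↦ ∫ y in 0..1, 1_A (θ y φ)`. That the shifts act measurably, jointly in `y` and `φ`,
rests on the identity kernel from `E` to `ℝ` being s-finite.

For part (b), the number `N(0, x]` inverts `n ↦ T n`, so that `N(0, x] / x → 1 / c` iff
`T n / n → c`, and then event averages up to `n` and `N_A(0, x] / x` converge together. Up to the
term `T 1`, `T n` is a Birkhoff sum of the gap `α 0`. If the conditional mean gap is finite,
Birkhoff's theorem applies on the invariant events on which it is at most `k`
(`ae_exists_pos_tendsto_gap`). If the averages of the gap converge, then truncation bounds the
integral of the gap over invariant events by that of the limit, so the conditional mean gap is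
finite (`ae_condMeanGap_lt_top`); it is positive because the gap is.
-/

/-! ### The pointwise ergodic theorem -/

section Ergodic

section Sums

variable {X : Type*} {S : X → X}

/-- The running maximum of the Birkhoff sums `birkhoffSum S g k x`, `k ≤ n`, written as a
recursion: `max 0 (g x + ·)` applied to the maximum of order `n - 1` at `S x`. -/
def birkhoffMaximum (S : X → X) (g : X → ℝ) : ℕ → X → ℝ
  | 0, _ => 0
  | n + 1, x => max 0 (g x + birkhoffMaximum S g n (S x))

theorem birkhoffMaximum_nonneg (g : X → ℝ) (n : ℕ) (x : X) : 0 ≤ birkhoffMaximum S g n x := by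
  cases n with
  | zero => exact le_rfl
  | succ n => exact le_max_left _ _

theorem birkhoffMaximum_le_succ (g : X → ℝ) (n : ℕ) (x : X) :
    birkhoffMaximum S g n x ≤ birkhoffMaximum S g (n + 1) x := by
  induction n generalizing x with
  | zero => exact birkhoffMaximum_nonneg g 1 x
  | succ n ih => exact max_le_max le_rfl (add_le_add le_rfl (ih (S x)))

theorem birkhoffMaximum_mono (g : X → ℝ) (x : X) :
    Monotone fun n => birkhoffMaximum S g n x :=
  monotone_nat_of_le_succ fun n => birkhoffMaximum_le_succ g n x

theorem birkhoffSum_le_birkhoffMaximum (g : X → ℝ) (n : ℕ) (x : X) :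
    birkhoffSum S g n x ≤ birkhoffMaximum S g n x := by
  induction n generalizing x with
  | zero => simp [birkhoffMaximum]
  | succ n ih =>
    rw [birkhoffSum_succ']
    exact (add_le_add le_rfl (ih (S x))).trans (le_max_right _ _)

/-- The points at which the Birkhoff sums of `g` are unbounded above. Unlike the set on which
`limsup (birkhoffSum S g n) / n` is positive, it is strictly invariant by inspection. -/
def unboundedSums (S : X → X) (g : X → ℝ) : Set X :=
  {x | ∀ C : ℕ, ∃ n, (C : ℝ) < birkhoffSum S g n x}

theorem preimage_unboundedSums (S : X → X) (g : X → ℝ) :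
    S ⁻¹' unboundedSums S g = unboundedSums S g := by
  ext x
  constructor
  · intro h C
    obtain ⟨C', hC'⟩ := exists_nat_ge (C - g x)
    obtain ⟨n, hn⟩ := h C'
    refine ⟨n + 1, ?_⟩
    rw [birkhoffSum_succ']
    linarith
  · intro h C
    obtain ⟨C', hC'⟩ := exists_nat_ge (C + g x)
    obtain ⟨n, hn⟩ := h C'
    cases n with
    | zero =>
      rw [birkhoffSum_zero] at hn
      exact absurd hn (not_lt.2 (Nat.cast_nonneg _))
    | succ n =>
      rw [birkhoffSum_succ'] at hn
      exact ⟨n, by linarith⟩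

theorem birkhoffSum_sub_const (f : X → ℝ) (b : ℝ) (n : ℕ) (x : X) :
    birkhoffSum S (fun y => f y - b) n x = birkhoffSum S f n x - n * b := by
  simp [birkhoffSum, Finset.sum_sub_distrib]

theorem birkhoffSum_const_sub (f : X → ℝ) (a : ℝ) (n : ℕ) (x : X) :
    birkhoffSum S (fun y => a - f y) n x = n * a - birkhoffSum S f n x := by
  simp [birkhoffSum, Finset.sum_sub_distrib]

end Sums

variable {X : Type*} [MeasurableSpace X] {μ : Measure X} {S : X → X}

theorem measurable_birkhoffSum (hS : Measurable S) {g : X → ℝ} (hg : Measurable g) (n : ℕ) :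
    Measurable (birkhoffSum S g n) := by
  unfold birkhoffSum
  exact Finset.measurable_sum _ fun i _ => hg.comp (hS.iterate i)

theorem MeasureTheory.MeasurePreserving.integral_comp_eq (hS : MeasurePreserving S μ μ)
    {F : X → ℝ} (hF : Measurable F) : ∫ x, F (S x) ∂μ = ∫ x, F x ∂μ := by
  conv_rhs => rw [← hS.map_eq]
  exact (integral_map hS.measurable.aemeasurable hF.aestronglyMeasurable).symm

theorem measurable_birkhoffMaximum (hS : Measurable S) {g : X → ℝ} (hg : Measurable g) (n : ℕ) :
    Measurable (birkhoffMaximum S g n) := by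
  induction n with
  | zero => exact measurable_const
  | succ n ih => exact measurable_const.max (hg.add (ih.comp hS))

theorem integrable_birkhoffMaximum (hS : MeasurePreserving S μ μ) {g : X → ℝ}
    (hg : Integrable g μ) (n : ℕ) : Integrable (birkhoffMaximum S g n) μ := by
  induction n with
  | zero => exact integrable_zero _ _ _
  | succ n ih => exact (integrable_zero _ _ _).sup (hg.add (hS.integrable_comp_of_integrable ih))

/-- The **maximal ergodic theorem**, in the case where almost every point has a positive Birkhoff
sum. Below, `μ` is a stationary measure restricted to an invariant set. -/
theorem integral_nonneg_of_exists_birkhoffSum_pos (hS : MeasurePreserving S μ μ) {g : X → ℝ}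
    (hgm : Measurable g) (hg : Integrable g μ) (hpos : ∀ᵐ x ∂μ, ∃ n, 0 < birkhoffSum S g n x) :
    0 ≤ ∫ x, g x ∂μ := by
  have hlim : Tendsto
      (fun n : ℕ => ∫ x, {x | 0 < birkhoffMaximum S g (n + 1) x}.indicator g x ∂μ)
      atTop (𝓝 (∫ x, g x ∂μ)) := by
    refine tendsto_integral_of_dominated_convergence (fun x => ‖g x‖) (fun n => ?_) hg.norm
      (fun n => ae_of_all _ fun x => norm_indicator_le_norm_self _ _) ?_
    · exact (hgm.indicator (measurableSet_lt measurable_const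
        (measurable_birkhoffMaximum hS.measurable hgm _))).aestronglyMeasurable
    · filter_upwards [hpos] with x ⟨k, hk⟩
      refine tendsto_const_nhds.congr' ?_
      filter_upwards [eventually_ge_atTop k] with n hn
      rw [indicator_of_mem]
      exact (hk.trans_le (birkhoffSum_le_birkhoffMaximum g k x)).trans_le
        (birkhoffMaximum_mono g x (hn.trans (Nat.le_succ n)))
  refine ge_of_tendsto' hlim fun n => ?_
  have hint := integrable_birkhoffMaximum hS hg (n + 1)
  have hintS := hS.integrable_comp_of_integrable hint
  calc (0 : ℝ) = ∫ x, birkhoffMaximum S g (n + 1) x - birkhoffMaximum S g (n + 1) (S x) ∂μ := by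
        rw [integral_sub hint (by exact hintS),
          hS.integral_comp_eq (measurable_birkhoffMaximum hS.measurable hgm _), sub_self]
    _ ≤ _ := by
        refine integral_mono (hint.sub hintS) (hg.indicator (measurableSet_lt measurable_const
          (measurable_birkhoffMaximum hS.measurable hgm _))) fun x => ?_
        by_cases hx : x ∈ {y | 0 < birkhoffMaximum S g (n + 1) y}
        · rw [indicator_of_mem hx]
          have h1 : birkhoffMaximum S g (n + 1) x = g x + birkhoffMaximum S g n (S x) := by
            have h2 : birkhoffMaximum S g (n + 1) x
              = max 0 (g x + birkhoffMaximum S g n (S x)) := rfl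
            rcases max_choice 0 (g x + birkhoffMaximum S g n (S x)) with h | h
            · rw [h] at h2; exact absurd h2 (ne_of_gt hx)
            · rw [h2, h]
          have h3 := birkhoffMaximum_le_succ (S := S) g n (S x)
          linarith
        · rw [indicator_of_notMem hx]
          have h3 := birkhoffMaximum_nonneg (S := S) g (n + 1) (S x)
          linarith [not_lt.1 (show ¬ 0 < birkhoffMaximum S g (n + 1) x from hx)]

theorem measurableSet_unboundedSums (hS : Measurable S) {g : X → ℝ} (hg : Measurable g) :
    MeasurableSet (unboundedSums S g) := by
  have : unboundedSums S g = ⋂ C : ℕ, ⋃ n, {x | (C : ℝ) < birkhoffSum S g n x} := by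
    ext x; simp [unboundedSums]
  rw [this]
  exact MeasurableSet.iInter fun C => MeasurableSet.iUnion fun n =>
    measurableSet_lt measurable_const (measurable_birkhoffSum hS hg n)

theorem setIntegral_nonneg_of_subset_unboundedSums (hS : MeasurePreserving S μ μ) {g : X → ℝ}
    (hgm : Measurable g) (hg : Integrable g μ) {D : Set X} (hD : MeasurableSet D)
    (hinv : S ⁻¹' D = D) (hsub : D ⊆ unboundedSums S g) : 0 ≤ ∫ x in D, g x ∂μ := by
  have h := hS.restrict_preimage hD
  rw [hinv] at h
  refine integral_nonneg_of_exists_birkhoffSum_pos h hgm hg.integrableOn ?_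
  filter_upwards [ae_restrict_mem hD] with x hx
  simpa using hsub hx 0

theorem exists_lt_mul_of_frequently {u : ℕ → ℝ} {c : ℝ} (hc : 0 < c)
    (h : ∃ᶠ n in atTop, n * c < u n) (C : ℕ) : ∃ n, (C : ℝ) < u n := by
  obtain ⟨k, hk⟩ := exists_nat_gt (C / c)
  obtain ⟨n, hn, hu⟩ := (frequently_atTop.1 h) k
  refine ⟨n, lt_of_le_of_lt ?_ hu⟩
  have h1 : (k : ℝ) ≤ n := by exact_mod_cast hn
  rw [div_lt_iff₀ hc] at hk
  nlinarith

/-- **Birkhoff's pointwise ergodic theorem** for a nonnegative integrable function, as the bare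
existence of a finite limit. -/
theorem ae_exists_tendsto_birkhoffSum_div [IsProbabilityMeasure μ] (hS : MeasurePreserving S μ μ)
    {f : X → ℝ} (hfm : Measurable f) (hf : Integrable f μ) (h0 : ∀ x, 0 ≤ f x) :
    ∀ᵐ x ∂μ, ∃ l : ℝ, Tendsto (fun n : ℕ => (1 / (n : ℝ)) * birkhoffSum S f n x) atTop (𝓝 l) := by
  have hU : ∀ b : ℝ, MeasurableSet (unboundedSums S fun y => f y - b) := fun b =>
    measurableSet_unboundedSums hS.measurable (hfm.sub_const b)
  have hV : ∀ a : ℝ, MeasurableSet (unboundedSums S fun y => a - f y) := fun a =>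
    measurableSet_unboundedSums hS.measurable (measurable_const.sub hfm)
  have hfin : ∀ᵐ x ∂μ, ∃ b : ℕ, x ∉ unboundedSums S fun y => f y - (b : ℝ) := by
    have hI : ∀ᵐ x ∂μ, x ∉ ⋂ b : ℕ, unboundedSums S fun y => f y - (b : ℝ) := by
      set D := ⋂ b : ℕ, unboundedSums S fun y => f y - (b : ℝ) with hDdef
      have hD : MeasurableSet D := MeasurableSet.iInter fun b => hU b
      have hinv : S ⁻¹' D = D := by
        rw [hDdef, preimage_iInter]
        simp_rw [preimage_unboundedSums]
      have hb : ∀ b : ℕ, (b : ℝ) * μ.real D ≤ ∫ x in D, f x ∂μ := fun b => by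
        have := setIntegral_nonneg_of_subset_unboundedSums hS (hfm.sub_const (b : ℝ))
          (hf.sub (integrable_const _)) hD hinv (iInter_subset _ b)
        rw [integral_sub hf.integrableOn (integrable_const _), setIntegral_const, smul_eq_mul] at this
        linarith
      have hz : μ.real D = 0 := by
        by_contra hne
        have hp : 0 < μ.real D := lt_of_le_of_ne measureReal_nonneg (Ne.symm hne)
        obtain ⟨b, hb'⟩ := exists_nat_gt ((∫ x in D, f x ∂μ) / μ.real D)
        rw [div_lt_iff₀ hp] at hb'
        exact absurd (hb b) (not_le.2 hb')
      exact measure_eq_zero_iff_ae_notMem.1 ((measureReal_eq_zero_iff).1 hz)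
    filter_upwards [hI] with x hx
    simpa using hx
  have hup : ∀ᵐ x ∂μ, ∀ a b : ℚ, a < b →
      x ∉ unboundedSums S (fun y => f y - (b : ℝ)) ∩ unboundedSums S (fun y => (a : ℝ) - f y) := by
    rw [ae_all_iff]; intro a
    rw [ae_all_iff]; intro b
    by_cases hab : a < b
    swap
    · exact ae_of_all _ fun x h => absurd h hab
    set D := unboundedSums S (fun y => f y - (b : ℝ)) ∩ unboundedSums S (fun y => (a : ℝ) - f y)
      with hDdef
    have hD : MeasurableSet D := (hU b).inter (hV a)
    have hinv : S ⁻¹' D = D := by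
      rw [hDdef, preimage_inter, preimage_unboundedSums, preimage_unboundedSums]
    have h1 := setIntegral_nonneg_of_subset_unboundedSums hS (hfm.sub_const (b : ℝ))
      (hf.sub (integrable_const _)) hD hinv inter_subset_left
    have h2 : 0 ≤ ∫ x in D, ((a : ℝ) - f x) ∂μ :=
      setIntegral_nonneg_of_subset_unboundedSums hS (measurable_const.sub hfm)
        ((integrable_const (a : ℝ)).sub hf) hD hinv inter_subset_right
    rw [integral_sub hf.integrableOn (integrable_const _), setIntegral_const, smul_eq_mul] at h1
    rw [integral_sub (integrable_const _) hf.integrableOn, setIntegral_const, smul_eq_mul] at h2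
    have hab' : (a : ℝ) < b := by exact_mod_cast hab
    have hz : μ.real D = 0 := by
      have : 0 ≤ μ.real D := measureReal_nonneg
      nlinarith
    filter_upwards [measure_eq_zero_iff_ae_notMem.1 ((measureReal_eq_zero_iff).1 hz)] with x hx _
    exact hx
  filter_upwards [hfin, hup] with x ⟨b, hb⟩ hx
  have hnn : ∀ n, 0 ≤ birkhoffSum S f n x := fun n => Finset.sum_nonneg fun i _ => h0 _
  refine tendsto_of_no_upcrossings Rat.denseRange_cast ?_ ?_ ?_
  · rintro _ ⟨a, rfl⟩ _ ⟨b, rfl⟩ hab ⟨h1, h2⟩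
    -- With `a < a' < b' < b`, an average above `b` puts the sum of `f - b'` above `n (b - b')`,
    -- which is unbounded; likewise for `a'`.
    obtain ⟨a', ha1, ha2⟩ := exists_rat_btwn hab
    obtain ⟨b', hb1, hb2⟩ := exists_rat_btwn ha2
    refine hx a' b' (by exact_mod_cast hb1) ⟨?_, ?_⟩
    · refine fun C => exists_lt_mul_of_frequently (sub_pos.2 hb2) ?_ C
      refine (h2.and_eventually (eventually_gt_atTop 0)).mono fun n ⟨hn, hn0⟩ => ?_
      have hn0' : (0 : ℝ) < n := by exact_mod_cast hn0
      rw [one_div, inv_mul_eq_div, lt_div_iff₀ hn0'] at hn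
      rw [birkhoffSum_sub_const]
      linarith
    · refine fun C => exists_lt_mul_of_frequently (sub_pos.2 ha1) ?_ C
      refine (h1.and_eventually (eventually_gt_atTop 0)).mono fun n ⟨hn, hn0⟩ => ?_
      have hn0' : (0 : ℝ) < n := by exact_mod_cast hn0
      rw [one_div, inv_mul_eq_div, div_lt_iff₀ hn0'] at hn
      rw [birkhoffSum_const_sub]
      linarith
  · simp only [unboundedSums, mem_ofPred_eq, not_forall, not_exists, not_lt] at hb
    obtain ⟨C, hC⟩ := hb
    refine ⟨b + C, eventually_map.2 ?_⟩
    filter_upwards [eventually_gt_atTop 0] with n hn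
    have hn1 : (1 : ℝ) ≤ n := by exact_mod_cast hn
    have h3 := hC n
    rw [birkhoffSum_sub_const] at h3
    rw [one_div, inv_mul_eq_div, div_le_iff₀ (by linarith)]
    have : (0 : ℝ) ≤ C := Nat.cast_nonneg _
    nlinarith
  · exact ⟨0, eventually_map.2 (Eventually.of_forall fun n =>
      mul_nonneg (by positivity) (hnn n))⟩

end Ergodic

/-! ### Setwise limits of probability measures -/

section Nikodym

/-- The union of the `f i` with `s i = true`. -/
def selectUnion {X : Type*} (f : ℕ → Set X) (s : ℕ → Bool) : Set X := ⋃ i, if s i then f i else ∅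

theorem mem_selectUnion {X : Type*} {f : ℕ → Set X} {s : ℕ → Bool} {x : X} :
    x ∈ selectUnion f s ↔ ∃ i, s i = true ∧ x ∈ f i := by
  simp only [selectUnion, mem_iUnion]
  refine exists_congr fun i => ?_
  split_ifs with h <;> simp [h]

variable {X : Type*} [MeasurableSpace X]

theorem measurableSet_selectUnion {f : ℕ → Set X} (hf : ∀ i, MeasurableSet (f i)) (s : ℕ → Bool) :
    MeasurableSet (selectUnion f s) :=
  MeasurableSet.iUnion fun i => by split_ifs; exacts [hf i, MeasurableSet.empty]

theorem tsum_measureReal_eq (μ : Measure X) [IsFiniteMeasure μ] {f : ℕ → Set X}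
    (hf : ∀ i, MeasurableSet (f i)) (hd : Pairwise (Function.onFun Disjoint f)) :
    ∑' i, μ.real (f i) = μ.real (⋃ i, f i) := by
  rw [measureReal_def, measure_iUnion hd hf, ENNReal.tsum_toReal_eq fun _ => measure_ne_top _ _]
  rfl

theorem continuous_measureReal_selectUnion (μ : Measure X) [IsFiniteMeasure μ] {f : ℕ → Set X}
    (hf : ∀ i, MeasurableSet (f i)) (hd : Pairwise (Function.onFun Disjoint f)) :
    Continuous fun s : ℕ → Bool => μ.real (selectUnion f s) := by
  have hsum : Summable fun i => μ.real (f i) := summable_measure_toReal hf hd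
  have heq : (fun s : ℕ → Bool => μ.real (selectUnion f s)) =
      fun s => ∑' i, (if s i then μ.real (f i) else 0) := by
    funext s
    rw [selectUnion, ← tsum_measureReal_eq]
    · refine tsum_congr fun i => ?_
      split_ifs <;> simp
    · intro i
      split_ifs; exacts [hf i, MeasurableSet.empty]
    · intro i j hij
      have := hd hij
      simp only [Function.onFun] at this ⊢
      split_ifs <;> simp [this]
  rw [heq]
  refine continuous_tsum (fun i => ?_) hsum fun i s => ?_
  · exact (continuous_of_discreteTopology (f := fun b : Bool => if b then μ.real (f i) else 0)).comp
      (continuous_apply i)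
  · split_ifs <;> simp [abs_of_nonneg]

/-- Uniform smallness of tails under setwise convergence, the heart of **Nikodym's convergence
theorem**. It comes from the Baire category theorem on the Cantor space of subsets of `ℕ`. -/
theorem exists_tail_le_of_tendsto (μ : ℕ → Measure X) [∀ n, IsFiniteMeasure (μ n)]
    (h : ∀ A, MeasurableSet A → ∃ l : ℝ, Tendsto (fun n => (μ n).real A) atTop (𝓝 l))
    {f : ℕ → Set X} (hf : ∀ i, MeasurableSet (f i)) (hd : Pairwise (Function.onFun Disjoint f))
    {ε : ℝ} (hε : 0 < ε) :
    ∃ K N, ∀ n ≥ N, (μ n).real (selectUnion f fun i => decide (K ≤ i)) ≤ ε := by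
  let C : ℕ → Set (ℕ → Bool) := fun N => ⋂ (m) (_ : N ≤ m) (n) (_ : N ≤ n),
    {s | |(μ n).real (selectUnion f s) - (μ m).real (selectUnion f s)| ≤ ε / 3}
  have hC : ∀ N, IsClosed (C N) := fun N =>
    isClosed_iInter fun m => isClosed_iInter fun _ => isClosed_iInter fun n => isClosed_iInter fun _ =>
      isClosed_le ((continuous_measureReal_selectUnion (μ n) hf hd).sub
        (continuous_measureReal_selectUnion (μ m) hf hd)).abs continuous_const
  have hCU : ⋃ N, C N = univ := by
    refine eq_univ_of_forall fun s => ?_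
    obtain ⟨l, hl⟩ := h _ (measurableSet_selectUnion hf s)
    obtain ⟨N, hN⟩ := Metric.cauchySeq_iff.1 hl.cauchySeq (ε / 3) (by positivity)
    refine mem_iUnion.2 ⟨N, ?_⟩
    simp only [C, mem_iInter]
    intro m hm n hn
    exact (hN n hn m hm).le
  obtain ⟨N, s, hs⟩ := nonempty_interior_of_iUnion_of_closed hC hCU
  obtain ⟨I, u, hu, hIu⟩ := isOpen_pi_iff.1 isOpen_interior s hs
  obtain ⟨K, hK⟩ : ∃ K, ∀ i ∈ I, i < K := ⟨I.sup id + 1, fun i hi =>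
    Nat.lt_succ_of_le (Finset.le_sup (f := id) hi)⟩
  have hcyl : ∀ s' : ℕ → Bool, (∀ i < K, s' i = s i) → s' ∈ C N := fun s' hs' =>
    interior_subset (hIu fun i hi => by
      rw [hs' i (hK i hi)]
      exact (hu i hi).2)
  -- Tails `[K', ∞)` with `K ≤ K'` are differences of two members of the cylinder around `s`.
  have hdiff : ∀ K' ≥ K, ∀ n ≥ N, (μ n).real (selectUnion f fun i => decide (K' ≤ i)) ≤
      (μ N).real (selectUnion f fun i => decide (K' ≤ i)) + 2 * (ε / 3) := by
    intro K' hK' n hn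
    set s1 : ℕ → Bool := fun i => if i < K then s i else decide (K' ≤ i) with hs1
    set s2 : ℕ → Bool := fun i => if i < K then s i else false with hs2
    have hunion : selectUnion f s1 = selectUnion f s2 ∪ selectUnion f fun i => decide (K' ≤ i) := by
      ext x
      simp only [mem_union, mem_selectUnion, ← exists_or, ← or_and_right, hs1, hs2, decide_eq_true_eq]
      refine exists_congr fun i => and_congr_left fun _ => ?_
      split_ifs with hi
      · simp only [iff_self_or]
        intro h; omega
      · simp
    have hdisj : Disjoint (selectUnion f s2) (selectUnion f fun i => decide (K' ≤ i)) := by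
      rw [Set.disjoint_left]
      intro x h1 h2
      obtain ⟨i, hi, hxi⟩ := mem_selectUnion.1 h1
      obtain ⟨j, hj, hxj⟩ := mem_selectUnion.1 h2
      have hij : i ≠ j := by
        rintro rfl
        simp only [hs2, decide_eq_true_eq] at hi hj
        split_ifs at hi with h
        · omega
      exact Set.disjoint_left.1 (hd hij) hxi hxj
    have hadd : ∀ k, (μ k).real (selectUnion f s1) = (μ k).real (selectUnion f s2) +
        (μ k).real (selectUnion f fun i => decide (K' ≤ i)) := fun k => by
      rw [hunion, measureReal_union hdisj (measurableSet_selectUnion hf _)]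
    have hm1 := hcyl s1 (fun i hi => by simp [hs1, hi])
    have hm2 := hcyl s2 (fun i hi => by simp [hs2, hi])
    simp only [C, mem_iInter] at hm1 hm2
    have e1 := hm1 N le_rfl n hn
    have e2 := hm2 N le_rfl n hn
    simp only [mem_ofPred_eq, hadd] at e1 e2
    rw [abs_le] at e1 e2
    linarith [e1.2, e2.1]
  have htail : Tendsto (fun k => (μ N).real (selectUnion f fun i => decide (k ≤ i))) atTop (𝓝 0) := by
    have hmt : Tendsto (fun k => (μ N) (selectUnion f fun i => decide (k ≤ i))) atTop
        (𝓝 ((μ N) (⋂ k, selectUnion f fun i => decide (k ≤ i)))) := by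
      refine tendsto_measure_iInter_atTop
        (fun k => (measurableSet_selectUnion hf _).nullMeasurableSet) ?_ ⟨0, measure_ne_top _ _⟩
      intro a b hab x hx
      obtain ⟨i, hi, hxi⟩ := mem_selectUnion.1 hx
      simp only [decide_eq_true_eq] at hi
      exact mem_selectUnion.2 ⟨i, by simpa using hab.trans hi, hxi⟩
    have hemp : (⋂ k, selectUnion f fun i => decide (k ≤ i)) = ∅ := by
      refine eq_empty_of_forall_notMem fun x hx => ?_
      rw [mem_iInter] at hx
      obtain ⟨i, -, hxi⟩ := mem_selectUnion.1 (hx 0)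
      obtain ⟨j, hj, hxj⟩ := mem_selectUnion.1 (hx (i + 1))
      simp only [decide_eq_true_eq] at hj
      exact Set.disjoint_left.1 (hd (show i ≠ j by omega)) hxi hxj
    rw [hemp, measure_empty] at hmt
    exact (ENNReal.tendsto_toReal ENNReal.zero_ne_top).comp hmt
  obtain ⟨K1, hK1⟩ :=
    eventually_atTop.1 (htail.eventually (ge_mem_nhds (show 0 < ε / 3 by positivity)))
  refine ⟨max K K1, N, fun n hn => ?_⟩
  have := hdiff (max K K1) (le_max_left _ _) n hn
  have := hK1 (max K K1) (le_max_right _ _)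
  linarith

/-- **Nikodym's convergence theorem** for probability measures: a setwise limit is a probability
measure. -/
theorem exists_isProbabilityMeasure_of_tendsto (μ : ℕ → Measure X) [∀ n, IsProbabilityMeasure (μ n)]
    (h : ∀ A, MeasurableSet A → ∃ l : ℝ, Tendsto (fun n => (μ n).real A) atTop (𝓝 l)) :
    ∃ Q : Measure X, IsProbabilityMeasure Q ∧
      ∀ A, MeasurableSet A → Tendsto (fun n => (μ n).real A) atTop (𝓝 (Q.real A)) := by
  choose! q hq using h
  have hq0 : ∀ A, MeasurableSet A → 0 ≤ q A := fun A hA =>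
    ge_of_tendsto' (hq A hA) fun n => measureReal_nonneg
  have hqmono : ∀ A B, MeasurableSet A → MeasurableSet B → A ⊆ B → q A ≤ q B := fun A B hA hB hAB =>
    le_of_tendsto_of_tendsto' (hq A hA) (hq B hB) fun n => measureReal_mono hAB
  have hqadd : ∀ A B, MeasurableSet A → MeasurableSet B → Disjoint A B → q (A ∪ B) = q A + q B :=
    fun A B hA hB hAB => by
      refine tendsto_nhds_unique (hq _ (hA.union hB)) (((hq A hA).add (hq B hB)).congr fun n => ?_)
      rw [measureReal_union hAB hB]
  have hqempty : q ∅ = 0 :=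
    tendsto_nhds_unique (hq ∅ MeasurableSet.empty) (by simp)
  have hsum : ∀ ⦃f : ℕ → Set X⦄, (∀ i, MeasurableSet (f i)) → Pairwise (Function.onFun Disjoint f) →
      HasSum (fun i => q (f i)) (q (⋃ i, f i)) := by
    intro f hf hd
    rw [hasSum_iff_tendsto_nat_of_nonneg (fun i => hq0 _ (hf i))]
    set R : ℕ → Set X := fun k => selectUnion f fun i => decide (k ≤ i) with hR
    have hRm : ∀ k, MeasurableSet (R k) := fun k => measurableSet_selectUnion hf _
    have hR0 : R 0 = ⋃ i, f i := by
      ext x; simp [hR, mem_selectUnion]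
    have hRsucc : ∀ k, R k = f k ∪ R (k + 1) := fun k => by
      ext x
      simp only [hR, mem_union, mem_selectUnion, decide_eq_true_eq]
      constructor
      · rintro ⟨i, hi, hx⟩
        rcases hi.eq_or_lt with rfl | h
        · exact Or.inl hx
        · exact Or.inr ⟨i, h, hx⟩
      · rintro (hx | ⟨i, hi, hx⟩)
        · exact ⟨k, le_rfl, hx⟩
        · exact ⟨i, by omega, hx⟩
    have hRdisj : ∀ k, Disjoint (f k) (R (k + 1)) := fun k => by
      rw [Set.disjoint_left]
      intro x hx hx'
      obtain ⟨j, hj, hxj⟩ := mem_selectUnion.1 hx'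
      simp only [decide_eq_true_eq] at hj
      exact Set.disjoint_left.1 (hd (show k ≠ j by omega)) hx hxj
    have hpart : ∀ k, ∑ i ∈ Finset.range k, q (f i) = q (⋃ i, f i) - q (R k) := fun k => by
      induction k with
      | zero => simp [hR0]
      | succ k ih =>
        have := hqadd _ _ (hf k) (hRm (k + 1)) (hRdisj k)
        rw [← hRsucc] at this
        rw [Finset.sum_range_succ, ih, this]
        ring
    have hRanti : ∀ a b, a ≤ b → R b ⊆ R a := fun a b hab x hx => by
      obtain ⟨i, hi, hxi⟩ := mem_selectUnion.1 hx
      simp only [decide_eq_true_eq] at hi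
      exact mem_selectUnion.2 ⟨i, by simpa using hab.trans hi, hxi⟩
    have hRlim : Tendsto (fun k => q (R k)) atTop (𝓝 0) := by
      rw [Metric.tendsto_atTop]
      intro ε hε
      obtain ⟨K, N, hKN⟩ := exists_tail_le_of_tendsto μ (fun A hA => ⟨q A, hq A hA⟩) hf hd
        (half_pos hε)
      refine ⟨K, fun k hk => ?_⟩
      have h1 : q (R K) ≤ ε / 2 := le_of_tendsto (hq _ (hRm K)) (eventually_atTop.2 ⟨N, hKN⟩)
      have h2 := hqmono _ _ (hRm k) (hRm K) (hRanti K k hk)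
      rw [Real.dist_eq, sub_zero, abs_of_nonneg (hq0 _ (hRm k))]
      linarith
    simp_rw [hpart]
    simpa using tendsto_const_nhds.sub hRlim
  let Q : Measure X := Measure.ofMeasurable (fun A _ => ENNReal.ofReal (q A)) (by simp [hqempty])
    (fun f hf hd => by
      rw [← (hsum hf hd).tsum_eq]
      exact ENNReal.ofReal_tsum_of_nonneg (fun i => hq0 _ (hf i)) (hsum hf hd).summable)
  have hQ : ∀ A, MeasurableSet A → Q A = ENNReal.ofReal (q A) := fun A hA =>
    Measure.ofMeasurable_apply A hA
  refine ⟨Q, ⟨?_⟩, fun A hA => ?_⟩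
  · rw [hQ _ MeasurableSet.univ]
    have : q univ = 1 := tendsto_nhds_unique (hq univ MeasurableSet.univ) (by simp)
    simp [this]
  · rw [measureReal_def, hQ A hA, ENNReal.toReal_ofReal (hq0 A hA)]
    exact hq A hA

end Nikodym

/-! ### Asymptotically mean stationary measures -/

section Averages

variable {X : Type*}

theorem sum_Icc_one_eq_birkhoffSum (S : X → X) (f : X → ℝ) (n : ℕ) (x : X) :
    ∑ i ∈ Finset.Icc 1 n, f (S^[i] x) = birkhoffSum S f n (S x) := by
  induction n with
  | zero => simp
  | succ n ih => rw [Finset.sum_Icc_succ_top (by omega), ih, birkhoffSum_succ,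
      Function.iterate_succ_apply]

theorem tendsto_birkhoffSum_div_apply_iff (S : X → X) (f : X → ℝ) (x : X) (l : ℝ) :
    Tendsto (fun n : ℕ => (1 / (n : ℝ)) * birkhoffSum S f n (S x)) atTop (𝓝 l) ↔
      Tendsto (fun n : ℕ => (1 / (n : ℝ)) * birkhoffSum S f n x) atTop (𝓝 l) := by
  have h0 : Tendsto (fun n : ℕ => 1 / ((n : ℝ) + 1)) atTop (𝓝 0) :=
    tendsto_one_div_add_atTop_nhds_zero_nat
  have h0' : Tendsto (fun n : ℕ => 1 / (n : ℝ)) atTop (𝓝 0) := tendsto_one_div_atTop_nhds_zero_nat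
  rw [← tendsto_add_atTop_iff_nat (f := fun n : ℕ => (1 / (n : ℝ)) * birkhoffSum S f n x) 1]
  constructor
  · intro h
    have h1 : Tendsto (fun n : ℕ => (1 - 1 / ((n : ℝ) + 1)) *
        ((1 / (n : ℝ)) * birkhoffSum S f n (S x)) + 1 / ((n : ℝ) + 1) * f x) atTop
        (𝓝 ((1 - 0) * l + 0 * f x)) :=
      ((tendsto_const_nhds.sub h0).mul h).add (h0.mul tendsto_const_nhds)
    simp only [sub_zero, one_mul, zero_mul, add_zero] at h1
    refine h1.congr' ?_
    filter_upwards [eventually_gt_atTop 0] with n hn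
    have : (n : ℝ) ≠ 0 := by positivity
    rw [birkhoffSum_succ']
    push_cast
    field_simp
    ring
  · intro h
    have h1 : Tendsto (fun n : ℕ => (1 + 1 / (n : ℝ)) *
        ((1 / ((n + 1 : ℕ) : ℝ)) * birkhoffSum S f (n + 1) x) - 1 / (n : ℝ) * f x) atTop
        (𝓝 ((1 + 0) * l - 0 * f x)) :=
      ((tendsto_const_nhds.add h0').mul h).sub (h0'.mul tendsto_const_nhds)
    simp only [add_zero, one_mul, zero_mul, sub_zero] at h1
    refine h1.congr' ?_
    filter_upwards [eventually_gt_atTop 0] with n hn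
    have : (n : ℝ) ≠ 0 := by positivity
    rw [birkhoffSum_succ']
    push_cast
    field_simp
    ring

theorem tendsto_average_shift {a : ℕ → ℝ} (ha : ∀ i, |a i| ≤ 1) {l : ℝ}
    (h : Tendsto (fun n : ℕ => (1 / (n : ℝ)) * ∑ i ∈ Finset.Icc 1 n, a i) atTop (𝓝 l)) :
    Tendsto (fun n : ℕ => (1 / (n : ℝ)) * ∑ i ∈ Finset.Icc 1 n, a (i + 1)) atTop (𝓝 l) := by
  have h0' : Tendsto (fun n : ℕ => 1 / (n : ℝ)) atTop (𝓝 0) := tendsto_one_div_atTop_nhds_zero_nat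
  have hb : Tendsto (fun n : ℕ => (1 / (n : ℝ)) * (a (n + 1) - a 1)) atTop (𝓝 0) := by
    refine squeeze_zero_norm (a := fun n : ℕ => (1 / (n : ℝ)) * 2) (fun n => ?_)
      (by simpa using h0'.mul_const 2)
    rw [norm_mul, Real.norm_of_nonneg (by positivity : 0 ≤ 1 / (n : ℝ))]
    refine mul_le_mul_of_nonneg_left ?_ (by positivity)
    exact (abs_sub _ _).trans (by linarith [ha (n + 1), ha 1])
  have := h.add hb
  rw [add_zero] at this
  refine this.congr fun n => ?_
  rw [← mul_add]
  congr 1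
  induction n with
  | zero => simp
  | succ n ih =>
    rw [Finset.sum_Icc_succ_top (by omega), Finset.sum_Icc_succ_top (by omega), ← ih]
    ring

end Averages

section AMS

variable {X : Type*} [MeasurableSpace X] {P Q : Measure X} {S : X → X}

/-- `P` is asymptotically mean stationary under `S` with stationary limit `Q`: the averages of the
laws of `S x, S (S x), …` under `P` converge to `Q` setwise. -/
def IsAMSWith (S : X → X) (P Q : Measure X) : Prop :=
  ∀ A, MeasurableSet A →
    Tendsto (fun n : ℕ => (1 / (n : ℝ)) * ∑ i ∈ Finset.Icc 1 n, P.real (S^[i] ⁻¹' A)) atTop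
      (𝓝 (Q.real A))

theorem IsAMSWith.measurePreserving [IsProbabilityMeasure P] [IsProbabilityMeasure Q]
    (hS : Measurable S) (h : IsAMSWith S P Q) : MeasurePreserving S Q Q := by
  refine ⟨hS, Measure.ext fun A hA => ?_⟩
  have h1 := tendsto_average_shift (a := fun i => P.real (S^[i] ⁻¹' A))
    (fun i => by rw [abs_of_nonneg measureReal_nonneg]; exact measureReal_le_one) (h A hA)
  have h2 := h _ (hS hA)
  have h3 : Q.real (S ⁻¹' A) = Q.real A := by
    refine tendsto_nhds_unique h2 (h1.congr fun n => ?_)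
    simp only [Function.iterate_succ', preimage_comp]
  rw [Measure.map_apply hS hA]
  exact (measureReal_eq_measureReal_iff).1 h3

theorem IsAMSWith.measureReal_eq (h : IsAMSWith S P Q) {C : Set X} (hC : MeasurableSet C)
    (hinv : S ⁻¹' C = C) : P.real C = Q.real C := by
  have hi : ∀ i, S^[i] ⁻¹' C = C := fun i => by
    induction i with
    | zero => rfl
    | succ i ih => rw [Function.iterate_succ', preimage_comp, hinv, ih]
  refine tendsto_nhds_unique ?_ (h C hC)
  refine tendsto_const_nhds.congr' ?_
  filter_upwards [eventually_gt_atTop 0] with n hn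
  have : (n : ℝ) ≠ 0 := by positivity
  simp only [hi, Finset.sum_const, Nat.card_Icc, nsmul_eq_mul, Nat.add_sub_cancel]
  field_simp

/-- `P` and its stationary limit agree on strictly invariant events, so these are almost sure
for both measures or for neither. -/
theorem IsAMSWith.ae_mem_iff [IsProbabilityMeasure P] [IsProbabilityMeasure Q]
    (h : IsAMSWith S P Q) {C : Set X} (hC : MeasurableSet C) (hinv : S ⁻¹' C = C) :
    (∀ᵐ x ∂P, x ∈ C) ↔ ∀ᵐ x ∂Q, x ∈ C := by
  have h1 := h.measureReal_eq hC.compl (by rw [preimage_compl, hinv])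
  rw [ae_iff, ae_iff]
  change P Cᶜ = 0 ↔ Q Cᶜ = 0
  rw [← measureReal_eq_zero_iff, ← measureReal_eq_zero_iff (μ := Q), h1]

theorem measurableSet_exists_tendsto_birkhoffSum (hS : Measurable S) {f : X → ℝ}
    (hf : Measurable f) : MeasurableSet
      {x | ∃ l : ℝ, Tendsto (fun n : ℕ => (1 / (n : ℝ)) * birkhoffSum S f n x) atTop (𝓝 l)} :=
  measurableSet_exists_tendsto fun n => (measurable_birkhoffSum hS hf n).const_mul _

theorem exists_tendsto_integral {F : ℕ → X → ℝ} [IsFiniteMeasure P]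
    (hF : ∀ n, Measurable (F n)) (hb : ∀ n x, |F n x| ≤ 1)
    (h : ∀ᵐ x ∂P, ∃ l : ℝ, Tendsto (fun n => F n x) atTop (𝓝 l)) :
    ∃ l : ℝ, Tendsto (fun n => ∫ x, F n x ∂P) atTop (𝓝 l) := by
  obtain ⟨L, hL⟩ := Filter.skolem.1 h
  exact ⟨_, tendsto_integral_of_dominated_convergence (fun _ => 1)
    (fun n => (hF n).aestronglyMeasurable) (integrable_const 1) (fun n => ae_of_all _ (hb n)) hL⟩

/-- A measure is asymptotically mean stationary iff the ergodic averages of indicators converge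
almost surely. -/
theorem exists_isAMSWith_iff [IsProbabilityMeasure P] (hS : Measurable S) :
    (∃ Q : Measure X, IsProbabilityMeasure Q ∧ IsAMSWith S P Q) ↔
      ∀ A, MeasurableSet A → ∀ᵐ x ∂P, ∃ l : ℝ, Tendsto (fun n : ℕ => (1 / (n : ℝ)) *
        ∑ i ∈ Finset.Icc 1 n, A.indicator (fun _ => (1 : ℝ)) (S^[i] x)) atTop (𝓝 l) := by
  constructor
  · rintro ⟨Q, hQ, h⟩ A hA
    simp_rw [sum_Icc_one_eq_birkhoffSum, tendsto_birkhoffSum_div_apply_iff]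
    have hf : Measurable (A.indicator fun _ => (1 : ℝ)) := measurable_const.indicator hA
    refine (h.ae_mem_iff (measurableSet_exists_tendsto_birkhoffSum hS hf) ?_).2 ?_
    · ext x
      simp only [mem_preimage, mem_ofPred_eq, tendsto_birkhoffSum_div_apply_iff]
    · exact ae_exists_tendsto_birkhoffSum_div (h.measurePreserving hS) hf
        ((integrable_const 1).indicator hA) fun x => indicator_nonneg (fun _ _ => zero_le_one) x
  · intro h
    let μ : ℕ → Measure X := fun n =>
      ((n + 1 : ℕ) : ℝ≥0∞)⁻¹ • ∑ i ∈ Finset.Icc 1 (n + 1), P.map (S^[i])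
    have hprob : ∀ i, IsProbabilityMeasure (P.map (S^[i])) := fun i =>
      Measure.isProbabilityMeasure_map (hS.iterate i).aemeasurable
    have hμ : ∀ n, IsProbabilityMeasure (μ n) := fun n => ⟨by
      simp only [μ, Measure.smul_apply, Measure.finsetSum_apply, measure_univ, Finset.sum_const,
        Nat.card_Icc, Nat.add_sub_cancel, nsmul_eq_mul, mul_one, smul_eq_mul]
      exact ENNReal.inv_mul_cancel (by simp) (ENNReal.natCast_ne_top _)⟩
    have hμA : ∀ n A, MeasurableSet A → (μ n).real A =
        (1 / ((n + 1 : ℕ) : ℝ)) * ∑ i ∈ Finset.Icc 1 (n + 1), P.real (S^[i] ⁻¹' A) := fun n A hA => by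
      simp only [μ, measureReal_def, Measure.smul_apply, Measure.finsetSum_apply, smul_eq_mul,
        ENNReal.toReal_mul, ENNReal.toReal_inv, ENNReal.toReal_natCast, one_div]
      rw [ENNReal.toReal_sum fun i _ => measure_ne_top _ _]
      congr 1
      exact Finset.sum_congr rfl fun i _ => by rw [Measure.map_apply (hS.iterate i) hA]
    obtain ⟨Q, hQ, hlim⟩ := exists_isProbabilityMeasure_of_tendsto μ fun A hA => by
      have hb : ∀ (n : ℕ) x, |(1 / (n : ℝ)) *
          ∑ i ∈ Finset.Icc 1 n, A.indicator (fun _ => (1 : ℝ)) (S^[i] x)| ≤ 1 := fun n x => by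
        have h0 : 0 ≤ ∑ i ∈ Finset.Icc 1 n, A.indicator (fun _ => (1 : ℝ)) (S^[i] x) :=
          Finset.sum_nonneg fun i _ => indicator_nonneg (fun _ _ => zero_le_one) _
        have h1 : ∑ i ∈ Finset.Icc 1 n, A.indicator (fun _ => (1 : ℝ)) (S^[i] x) ≤ n := by
          refine (Finset.sum_le_sum (g := fun _ => (1 : ℝ)) fun i _ => ?_).trans (by simp)
          exact indicator_le_self' (fun _ _ => zero_le_one) _
        rw [abs_of_nonneg (by positivity), one_div, inv_mul_eq_div]
        exact div_le_one_of_le₀ h1 (Nat.cast_nonneg _)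
      obtain ⟨l, hl⟩ := exists_tendsto_integral (P := P) (F := fun (n : ℕ) x => (1 / (n : ℝ)) *
        ∑ i ∈ Finset.Icc 1 n, A.indicator (fun _ => (1 : ℝ)) (S^[i] x))
        (fun n => (Finset.measurable_sum _ fun i _ =>
          (measurable_const.indicator hA).comp (hS.iterate i)).const_mul _) hb (h A hA)
      refine ⟨l, ((tendsto_add_atTop_iff_nat 1).2 hl).congr fun n => ?_⟩
      rw [hμA n A hA, integral_const_mul, integral_finsetSum]
      · congr 1
        refine Finset.sum_congr rfl fun i _ => ?_
        have : (fun x => A.indicator (fun _ => (1 : ℝ)) (S^[i] x)) =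
          (S^[i] ⁻¹' A).indicator 1 := rfl
        rw [this, integral_indicator_one (hS.iterate i hA)]
      · exact fun i _ => (integrable_const (1 : ℝ)).indicator (hS.iterate i hA)
    refine ⟨Q, hQ, fun A hA => ?_⟩
    rw [← tendsto_add_atTop_iff_nat 1]
    exact (hlim A hA).congr fun n => hμA n A hA

/-- If the ergodic averages of `f ≥ 0` converge to `L`, then `∫ f ≤ ∫ L`, with no integrability
assumption on `f`. Concavity of `min · k` lets one truncate and apply dominated convergence. -/
theorem lintegral_le_of_tendsto_birkhoffSum [IsFiniteMeasure Q] (hS : MeasurePreserving S Q Q)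
    {f L : X → ℝ} (hf : Measurable f) (h0 : ∀ x, 0 ≤ f x)
    (h : ∀ᵐ x ∂Q, Tendsto (fun n : ℕ => (1 / (n : ℝ)) * birkhoffSum S f n x) atTop (𝓝 (L x))) :
    ∫⁻ x, ENNReal.ofReal (f x) ∂Q ≤ ∫⁻ x, ENNReal.ofReal (L x) ∂Q := by
  have hB : ∀ n, Measurable (birkhoffSum S f n) := measurable_birkhoffSum hS.measurable hf
  have hLm : AEMeasurable L Q := aemeasurable_of_tendsto_metrizable_ae atTop
    (fun n => ((hB n).const_mul _).aemeasurable) h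
  have hL0 : ∀ᵐ x ∂Q, 0 ≤ L x := by
    filter_upwards [h] with x hx
    exact ge_of_tendsto' hx fun n => mul_nonneg (by positivity) (Finset.sum_nonneg fun i _ => h0 _)
  have hmf : ∀ k : ℕ, Measurable fun x => min (f x) (k : ℝ) := fun k => hf.min measurable_const
  have hbd : ∀ (k : ℕ) {y : ℝ}, 0 ≤ y → ‖min y (k : ℝ)‖ ≤ k := fun k y hy => by
    rw [Real.norm_of_nonneg (le_min hy (Nat.cast_nonneg k))]
    exact min_le_right _ _
  have hif : ∀ k : ℕ, Integrable (fun x => min (f x) (k : ℝ)) Q := fun k =>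
    (integrable_const (k : ℝ)).mono' (hmf k).aestronglyMeasurable
      (ae_of_all _ fun x => hbd k (h0 x))
  have hiL : ∀ k : ℕ, Integrable (fun x => min (L x) (k : ℝ)) Q := fun k =>
    (integrable_const (k : ℝ)).mono' (hLm.min aemeasurable_const).aestronglyMeasurable
      (hL0.mono fun x hx => hbd k hx)
  have hav : ∀ (n : ℕ) x, 0 ≤ (1 / (n : ℝ)) * birkhoffSum S f n x := fun n x =>
    mul_nonneg (by positivity) (Finset.sum_nonneg fun i _ => h0 _)
  have hk : ∀ k : ℕ, ∫ x, min (f x) (k : ℝ) ∂Q ≤ ∫ x, min (L x) (k : ℝ) ∂Q := fun k => by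
    have hlim : Tendsto (fun n : ℕ => ∫ x, min ((1 / (n : ℝ)) * birkhoffSum S f n x) (k : ℝ) ∂Q)
        atTop (𝓝 (∫ x, min (L x) (k : ℝ) ∂Q)) := by
      refine tendsto_integral_of_dominated_convergence (fun _ => (k : ℝ))
        (fun n => (((hB n).const_mul _).min measurable_const).aestronglyMeasurable)
        (integrable_const _) (fun n => ae_of_all _ fun x => hbd k (hav n x)) ?_
      filter_upwards [h] with x hx
      exact hx.min tendsto_const_nhds
    refine ge_of_tendsto hlim ?_
    filter_upwards [eventually_gt_atTop 0] with n hn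
    have hn' : (n : ℝ) ≠ 0 := by positivity
    have hint : ∀ i, Integrable (fun x => min (f (S^[i] x)) (k : ℝ)) Q := fun i =>
      (hS.iterate i).integrable_comp_of_integrable (hif k)
    calc ∫ x, min (f x) (k : ℝ) ∂Q
        = ∫ x, (1 / (n : ℝ)) * ∑ i ∈ Finset.range n, min (f (S^[i] x)) (k : ℝ) ∂Q := by
          rw [integral_const_mul, integral_finsetSum _ fun i _ => hint i,
            Finset.sum_congr rfl fun i _ => (hS.iterate i).integral_comp_eq (hmf k)]
          simp only [Finset.sum_const, Finset.card_range, nsmul_eq_mul]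
          field_simp
      _ ≤ ∫ x, min ((1 / (n : ℝ)) * birkhoffSum S f n x) (k : ℝ) ∂Q := by
          refine integral_mono ((integrable_finsetSum _ fun i _ => hint i).const_mul _)
            ((integrable_const (k : ℝ)).mono'
              (((hB n).const_mul _).min measurable_const).aestronglyMeasurable
              (ae_of_all _ fun x => hbd k (hav n x))) fun x => le_min ?_ ?_
          · exact mul_le_mul_of_nonneg_left (Finset.sum_le_sum fun i _ => min_le_left _ _)
              (by positivity)
          · have : ∑ i ∈ Finset.range n, min (f (S^[i] x)) (k : ℝ) ≤ n * k := by
              refine (Finset.sum_le_sum fun i _ => min_le_right _ _).trans ?_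
              simp
            calc _ ≤ (1 / (n : ℝ)) * (n * k) := mul_le_mul_of_nonneg_left this (by positivity)
              _ = k := by field_simp
  have hk' : ∀ k : ℕ, ∫⁻ x, ENNReal.ofReal (min (f x) (k : ℝ)) ∂Q ≤
      ∫⁻ x, ENNReal.ofReal (L x) ∂Q := fun k => by
    rw [← ofReal_integral_eq_lintegral_ofReal (hif k)
      (ae_of_all _ fun x => le_min (h0 x) (Nat.cast_nonneg k))]
    refine (ENNReal.ofReal_le_ofReal (hk k)).trans ?_
    rw [ofReal_integral_eq_lintegral_ofReal (hiL k)
      (hL0.mono fun x hx => le_min hx (Nat.cast_nonneg k))]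
    exact lintegral_mono fun x => ENNReal.ofReal_le_ofReal (min_le_left _ _)
  have hmono : ∫⁻ x, ENNReal.ofReal (f x) ∂Q =
      ⨆ k : ℕ, ∫⁻ x, ENNReal.ofReal (min (f x) (k : ℝ)) ∂Q := by
    rw [← lintegral_iSup (fun k => (hmf k).ennreal_ofReal) fun a b hab x =>
      ENNReal.ofReal_le_ofReal (min_le_min_left _ (Nat.cast_le.2 hab))]
    refine lintegral_congr fun x => le_antisymm ?_ ?_
    · obtain ⟨k, hk⟩ := exists_nat_ge (f x)
      refine le_iSup_of_le k ?_
      rw [min_eq_left hk]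
    · exact iSup_le fun k => ENNReal.ofReal_le_ofReal (min_le_left _ _)
  rw [hmono]
  exact iSup_le hk'

theorem setLIntegral_le_of_tendsto_birkhoffSum [IsFiniteMeasure Q] (hS : MeasurePreserving S Q Q)
    {f L : X → ℝ} (hf : Measurable f) (h0 : ∀ x, 0 ≤ f x) {D : Set X} (hD : MeasurableSet D)
    (hinv : S ⁻¹' D = D)
    (h : ∀ᵐ x ∂Q, x ∈ D →
      Tendsto (fun n : ℕ => (1 / (n : ℝ)) * birkhoffSum S f n x) atTop (𝓝 (L x))) :
    ∫⁻ x in D, ENNReal.ofReal (f x) ∂Q ≤ ∫⁻ x in D, ENNReal.ofReal (L x) ∂Q := by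
  have hr := hS.restrict_preimage hD
  rw [hinv] at hr
  exact lintegral_le_of_tendsto_birkhoffSum hr hf h0 ((ae_restrict_iff' hD).2 h)

/-- The ergodic averages of a positive function do not converge to `0`. -/
theorem ae_not_tendsto_birkhoffSum_zero [IsFiniteMeasure Q] (hS : MeasurePreserving S Q Q)
    {f : X → ℝ} (hf : Measurable f) (h0 : ∀ x, 0 < f x) :
    ∀ᵐ x ∂Q, ¬ Tendsto (fun n : ℕ => (1 / (n : ℝ)) * birkhoffSum S f n x) atTop (𝓝 0) := by
  set D := {x | Tendsto (fun n : ℕ => (1 / (n : ℝ)) * birkhoffSum S f n x) atTop (𝓝 0)} with hDdef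
  have hD : MeasurableSet D := measurableSet_tendsto (𝓝 (0 : ℝ)) fun n =>
    (measurable_birkhoffSum hS.measurable hf n).const_mul _
  have hinv : S ⁻¹' D = D := by
    ext x
    simp only [hDdef, mem_preimage, mem_ofPred_eq, tendsto_birkhoffSum_div_apply_iff]
  have h1 := setLIntegral_le_of_tendsto_birkhoffSum hS (L := fun _ => 0) hf (fun x => (h0 x).le)
    hD hinv (ae_of_all _ fun x hx => hx)
  simp only [ENNReal.ofReal_zero, lintegral_zero, nonpos_iff_eq_zero] at h1
  rw [setLIntegral_eq_zero_iff hD hf.ennreal_ofReal] at h1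
  filter_upwards [h1] with x hx hxD
  exact absurd (hx hxD) (by simpa using h0 x)

end AMS

/-! ### Measurability of shifts and points -/

namespace PointProcess

open ProbabilityTheory

/-- The identity kernel `φ ↦ φ` from `E` to `ℝ`. -/
noncomputable def idKernel : Kernel E ℝ := ⟨fun φ => φ.1, measurable_subtype_coe⟩

theorem measurable_eval {B : Set ℝ} (hB : MeasurableSet B) : Measurable fun φ : E => φ.1 B :=
  (Measure.measurable_coe hB).comp measurable_subtype_coe

theorem measure_Ioc_lt_top (φ : E) (a b : ℝ) : φ.1 (Ioc a b) < ∞ :=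
  φ.2.2 _ measurableSet_Ioc (Metric.isBounded_Ioc a b)

theorem exists_measure_Ioc_eq (φ : E) (a b : ℝ) : ∃ k : ℕ, φ.1 (Ioc a b) = k := by
  obtain ⟨k, hk⟩ := φ.2.1 (Ioc a b) measurableSet_Ioc
  have h := measure_Ioc_lt_top φ a b
  rw [hk] at h
  cases k with
  | top => simp at h
  | coe k => exact ⟨k, by simpa using hk⟩

open scoped Classical in
/-- The identity kernel is s-finite: restrict it to `(j, j + 1]` and to the event that this
interval contains exactly `k` points, for `j ∈ ℤ` and `k ∈ ℕ`. -/
instance : IsSFiniteKernel idKernel := by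
  have hms : ∀ (j : ℤ) (k : ℕ), MeasurableSet {φ : E | φ.1 (Ioc (j : ℝ) (j + 1)) = k} := fun j k =>
    measurable_eval measurableSet_Ioc (measurableSet_singleton _)
  let κ : ℤ × ℕ → Kernel E ℝ := fun p =>
    Kernel.piecewise (hms p.1 p.2)
      (idKernel.restrict (measurableSet_Ioc (a := (p.1 : ℝ)) (b := p.1 + 1))) 0
  have hfin : ∀ p, IsFiniteKernel (κ p) := fun p => ⟨⟨(p.2 : ℝ≥0∞), by simp, fun φ => by
    simp only [κ, Kernel.piecewise_apply]
    split_ifs with h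
    · rw [Kernel.restrict_apply, Measure.restrict_apply_univ]
      exact le_of_eq h
    · simp⟩⟩
  have hsum : idKernel = Kernel.sum κ := by
    refine Kernel.ext fun φ => Measure.ext fun B hB => ?_
    rw [Kernel.sum_apply, Measure.sum_apply _ hB, ENNReal.tsum_prod']
    have hB' : B = ⋃ j : ℤ, B ∩ Ioc (j : ℝ) (j + 1) := by
      rw [← inter_iUnion, iUnion_Ioc_intCast, inter_univ]
    have hpd : Pairwise (Function.onFun Disjoint fun j : ℤ => B ∩ Ioc (j : ℝ) (j + 1)) :=
      fun i j hij => (pairwise_disjoint_Ioc_intCast ℝ hij).mono inter_subset_right inter_subset_right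
    conv_lhs => rw [hB', measure_iUnion hpd fun j => hB.inter measurableSet_Ioc]
    refine tsum_congr fun j => ?_
    obtain ⟨k, hk⟩ := exists_measure_Ioc_eq φ j (j + 1)
    rw [tsum_eq_single k]
    · simp only [κ, Kernel.piecewise_apply]
      rw [if_pos (by exact hk), Kernel.restrict_apply, Measure.restrict_apply hB]
    · intro k' hk'
      simp only [κ, Kernel.piecewise_apply]
      rw [if_neg]
      · simp
      · intro h
        have h' : φ.1 (Ioc (j : ℝ) (j + 1)) = k' := h
        rw [hk] at h'
        exact hk' (by exact_mod_cast h'.symm)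
  rw [hsum]
  infer_instance

theorem measurable_measure_section {Y : Type*} [MeasurableSpace Y] {s : Y → E} (hs : Measurable s)
    {t : Set (Y × ℝ)} (ht : MeasurableSet t) : Measurable fun y => (s y).1 (Prod.mk y ⁻¹' t) :=
  Kernel.measurable_kernel_prodMk_left (κ := idKernel.comap s hs) ht

/-- The time-shift is jointly measurable in the time and the point process. -/
theorem measurable_θ : Measurable fun p : ℝ × E => θ p.1 p.2 := by
  refine Measurable.subtype_mk (Measure.measurable_of_measurable_coe _ fun B hB => ?_)
  have h := measurable_measure_section (s := fun p : ℝ × E => p.2) measurable_snd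
    (t := {q : (ℝ × E) × ℝ | q.2 - q.1.1 ∈ B})
    ((by fun_prop : Measurable fun q : (ℝ × E) × ℝ => q.2 - q.1.1) hB)
  have heq : (fun p : ℝ × E => (θ p.1 p.2).1 B) =
      fun p => p.2.1 (Prod.mk p ⁻¹' {q : (ℝ × E) × ℝ | q.2 - q.1.1 ∈ B}) :=
    funext fun p => map_sub_apply p.2.1 p.1 hB
  change Measurable fun p : ℝ × E => (θ p.1 p.2).1 B
  rw [heq]
  exact h

theorem measurableSet_M : MeasurableSet M := by
  -- `φ` has no multiple points iff `φ {y | 2 ≤ φ {y}} = 0`.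
  have h1 : Measurable fun p : E × ℝ => p.1.1 {p.2} := by
    have h := measurable_measure_section (s := fun p : E × ℝ => p.1) measurable_fst
      (t := {q : (E × ℝ) × ℝ | q.2 = q.1.2})
      (measurableSet_eq_fun (by fun_prop) (by fun_prop))
    exact h
  have h2 : Measurable fun φ : E => φ.1 {y | 1 < φ.1 {y}} :=
    measurable_measure_section (s := fun φ : E => φ) measurable_id
      (t := {q : E × ℝ | 1 < q.1.1 {q.2}}) (measurableSet_lt measurable_const h1)
  have : M = {φ | 0 < φ.1 univ} ∩ {φ : E | φ.1 {y | 1 < φ.1 {y}} = 0} := by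
    ext φ
    refine and_congr_right fun _ => ⟨fun h => ?_, fun h y => ?_⟩
    · have he : {y | 1 < φ.1 {y}} = ∅ := eq_empty_of_forall_notMem fun y hy => not_lt.2 (h y) hy
      change φ.1 {y | 1 < φ.1 {y}} = 0
      rw [he, measure_empty]
    · by_contra hy
      rw [not_le] at hy
      have h3 : φ.1 {y} ≤ φ.1 {y | 1 < φ.1 {y}} := measure_mono (by simpa using hy)
      have h' : φ.1 {y | 1 < φ.1 {y}} = 0 := h
      rw [h', nonpos_iff_eq_zero] at h3
      rw [h3] at hy
      simp at hy
  rw [this]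
  exact (measurableSet_lt measurable_const (measurable_eval MeasurableSet.univ)).inter
    (h2 (measurableSet_singleton 0))

theorem measurableSet_Minf : MeasurableSet Minf :=
  measurableSet_M.inter ((measurable_eval measurableSet_Iic (measurableSet_singleton _)).inter
    (measurable_eval measurableSet_Ioi (measurableSet_singleton _)))

theorem measurable_T (n : ℤ) : Measurable (T n) := by
  by_cases hn : 0 < n
  · refine measurable_of_Iio fun c => ?_
    have : T n ⁻¹' Iio c = ⋃ q : ℚ, {φ : E | 0 < (q : ℝ) ∧ ((q : ℝ) : EReal) < c ∧
        (n.toNat : ℝ≥0∞) ≤ φ.1 (Ioc 0 (q : ℝ))} := by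
      ext φ
      simp only [mem_preimage, mem_Iio, T, if_pos hn, mem_iUnion, mem_ofPred_eq, sInf_lt_iff]
      constructor
      · rintro ⟨_, ⟨t, ⟨ht0, ht⟩, rfl⟩, htc⟩
        obtain ⟨q, h1, h2⟩ := EReal.lt_iff_exists_rat_btwn.1 htc
        have h1' : t < q := EReal.coe_lt_coe_iff.1 h1
        exact ⟨q, ht0.trans h1', h2, ht.trans (measure_mono (Ioc_subset_Ioc_right h1'.le))⟩
      · rintro ⟨q, h1, h2, h3⟩
        exact ⟨_, ⟨q, ⟨h1, h3⟩, rfl⟩, h2⟩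
    rw [this]
    refine MeasurableSet.iUnion fun q => ?_
    exact (MeasurableSet.const _).inter ((MeasurableSet.const _).inter
      (measurableSet_le measurable_const (measurable_eval measurableSet_Ioc)))
  · refine measurable_of_Ioi fun c => ?_
    have : T n ⁻¹' Ioi c = ⋃ q : ℚ, {φ : E | (q : ℝ) ≤ 0 ∧ c < ((q : ℝ) : EReal) ∧
        ((1 - n).toNat : ℝ≥0∞) ≤ φ.1 (Icc (q : ℝ) 0)} := by
      ext φ
      simp only [mem_preimage, mem_Ioi, T, if_neg hn, mem_iUnion, mem_ofPred_eq, lt_sSup_iff]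
      constructor
      · rintro ⟨_, ⟨t, ⟨ht0, ht⟩, rfl⟩, htc⟩
        obtain ⟨q, h1, h2⟩ := EReal.lt_iff_exists_rat_btwn.1 htc
        have h2' : (q : ℝ) < t := EReal.coe_lt_coe_iff.1 h2
        exact ⟨q, h2'.le.trans ht0, h1, ht.trans (measure_mono (Icc_subset_Icc_left h2'.le))⟩
      · rintro ⟨q, h1, h2, h3⟩
        exact ⟨_, ⟨q, ⟨h1, h3⟩, rfl⟩, h2⟩
    rw [this]
    refine MeasurableSet.iUnion fun q => ?_
    exact (MeasurableSet.const _).inter ((MeasurableSet.const _).inter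
      (measurableSet_le measurable_const (measurable_eval measurableSet_Icc)))

theorem measurable_η (n : ℤ) : Measurable (η n) :=
  measurable_θ.comp ((measurable_T n).ereal_toReal.prodMk measurable_id)

theorem measurable_α (n : ℤ) : Measurable (α n) :=
  (measurable_T (n + 1)).ereal_toReal.sub (measurable_T n).ereal_toReal

theorem θ_θ (a b : ℝ) (φ : E) : θ a (θ b φ) = θ (b + a) φ := by
  apply Subtype.ext
  simp only [θ]
  rw [Measure.map_map (by fun_prop) (by fun_prop)]
  congr 1
  funext t
  simp only [Function.comp]
  ring

theorem θ_zero (φ : E) : θ 0 φ = φ := by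
  apply Subtype.ext
  simp [θ]

theorem θ_apply (y : ℝ) (φ : E) {B : Set ℝ} (hB : MeasurableSet B) :
    (θ y φ).1 B = φ.1 ((fun t => t - y) ⁻¹' B) := map_sub_apply _ _ hB

/-! ### The points of a point process on both half-lines -/

variable {φ : E}

/-- For `n ≥ 1`, `T n φ` is attained: it is the least `t` with `n` points in `(0, t]`. -/
theorem exists_T_eq (h : φ ∈ Minf) {n : ℕ} (hn : 1 ≤ n) :
    ∃ τ : ℝ, T n φ = τ ∧ 0 < τ ∧ ∀ t, (n : ℝ≥0∞) ≤ φ.1 (Ioc 0 t) ↔ τ ≤ t := by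
  set s : Set ℝ := {t | (n : ℝ≥0∞) ≤ φ.1 (Ioc 0 t)} with hs
  have hpos : ∀ t ∈ s, 0 < t := fun t ht => by
    by_contra hc
    have ht' : (n : ℝ≥0∞) ≤ φ.1 (Ioc 0 t) := ht
    rw [Ioc_eq_empty hc, measure_empty] at ht'
    simp at ht'
    omega
  have hup : ∀ {a b}, a ∈ s → a ≤ b → b ∈ s := fun ha hab =>
    le_trans ha (measure_mono (Ioc_subset_Ioc_right hab))
  have hne : s.Nonempty := by
    have hmono : Monotone fun k : ℕ => Ioc (0 : ℝ) k := fun a b hab =>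
      Ioc_subset_Ioc_right (Nat.cast_le.2 hab)
    have hU : ⋃ k : ℕ, Ioc (0 : ℝ) k = Ioi 0 := by
      ext t
      simp only [mem_iUnion, mem_Ioc, mem_Ioi, exists_and_left, and_iff_left_iff_imp]
      exact fun _ => exists_nat_ge t
    have ht := tendsto_measure_iUnion_atTop (μ := φ.1) hmono
    rw [hU, h.2.2] at ht
    obtain ⟨k, hk⟩ := (ht.eventually (lt_mem_nhds (ENNReal.natCast_lt_top n))).exists
    exact ⟨k, hk.le⟩
  have hbdd : BddBelow s := ⟨0, fun t ht => (hpos t ht).le⟩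
  -- Right-continuity of `t ↦ φ (0, t]`.
  have hmem : sInf s ∈ s := by
    have hanti : Antitone fun k : ℕ => Ioc (0 : ℝ) (sInf s + 1 / ((k : ℝ) + 1)) := fun a b hab =>
      Ioc_subset_Ioc_right (by gcongr)
    have hI : ⋂ k : ℕ, Ioc (0 : ℝ) (sInf s + 1 / ((k : ℝ) + 1)) = Ioc 0 (sInf s) := by
      ext t
      simp only [mem_iInter, mem_Ioc]
      refine ⟨fun ht => ⟨(ht 0).1, ?_⟩, fun ht k => ⟨ht.1, ht.2.trans (by
        have : 0 < 1 / ((k : ℝ) + 1) := by positivity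
        linarith)⟩⟩
      have hl : Tendsto (fun k : ℕ => sInf s + 1 / ((k : ℝ) + 1)) atTop (𝓝 (sInf s + 0)) :=
        tendsto_const_nhds.add tendsto_one_div_add_atTop_nhds_zero_nat
      rw [add_zero] at hl
      exact ge_of_tendsto' hl fun k => (ht k).2
    have ht := tendsto_measure_iInter_atTop (μ := φ.1)
      (fun k : ℕ => (measurableSet_Ioc (a := (0 : ℝ))
        (b := sInf s + 1 / ((k : ℝ) + 1))).nullMeasurableSet)
      hanti ⟨0, (measure_Ioc_lt_top φ _ _).ne⟩
    rw [hI] at ht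
    refine ge_of_tendsto' ht fun k => ?_
    obtain ⟨t, hts, htl⟩ := exists_lt_of_csInf_lt hne
      (show sInf s < sInf s + 1 / ((k : ℝ) + 1) by
        linarith [show 0 < 1 / ((k : ℝ) + 1) by positivity])
    exact hup hts htl.le
  have hiff : ∀ t, (n : ℝ≥0∞) ≤ φ.1 (Ioc 0 t) ↔ sInf s ≤ t := fun t =>
    ⟨fun ht => csInf_le hbdd ht, fun ht => hup hmem ht⟩
  refine ⟨sInf s, ?_, hpos _ hmem, hiff⟩
  have hn' : (0 : ℤ) < n := by omega
  simp only [T, if_pos hn', Int.toNat_natCast]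
  refine IsGLB.sInf_eq (IsLeast.isGLB ⟨⟨sInf s, ⟨hpos _ hmem, hmem⟩, rfl⟩, ?_⟩)
  rintro _ ⟨t, ⟨-, ht⟩, rfl⟩
  exact EReal.coe_le_coe_iff.2 ((hiff t).1 ht)

/-- The `n`-th point as a real number. -/
noncomputable def τ (φ : E) (n : ℕ) : ℝ := (T n φ).toReal

theorem T_eq_τ (h : φ ∈ Minf) {n : ℕ} (hn : 1 ≤ n) : T n φ = τ φ n := by
  obtain ⟨t, ht, -⟩ := exists_T_eq h hn
  rw [τ, ht, EReal.toReal_coe]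

theorem τ_pos (h : φ ∈ Minf) {n : ℕ} (hn : 1 ≤ n) : 0 < τ φ n := by
  obtain ⟨t, ht, h0, -⟩ := exists_T_eq h hn
  rwa [τ, ht, EReal.toReal_coe]

theorem le_measure_Ioc_iff (h : φ ∈ Minf) {n : ℕ} (hn : 1 ≤ n) (t : ℝ) :
    (n : ℝ≥0∞) ≤ φ.1 (Ioc 0 t) ↔ τ φ n ≤ t := by
  obtain ⟨s, hs, -, hiff⟩ := exists_T_eq h hn
  rw [τ, hs, EReal.toReal_coe, hiff]

/-- Fewer than `n` points lie strictly between `0` and the `n`-th point. -/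
theorem measure_Ioo_τ_le (h : φ ∈ Minf) {n : ℕ} (hn : 1 ≤ n) :
    φ.1 (Ioo 0 (τ φ n)) ≤ (n - 1 : ℕ) := by
  set t := τ φ n with ht
  have hmono : Monotone fun k : ℕ => Ioc (0 : ℝ) (t - 1 / ((k : ℝ) + 1)) := fun a b hab =>
    Ioc_subset_Ioc_right (by gcongr)
  have hU : ⋃ k : ℕ, Ioc (0 : ℝ) (t - 1 / ((k : ℝ) + 1)) = Ioo 0 t := by
    ext s
    simp only [mem_iUnion, mem_Ioc, mem_Ioo, exists_and_left]
    refine and_congr_right fun _ => ⟨fun ⟨k, hk⟩ => ?_, fun hs => ?_⟩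
    · linarith [show 0 < 1 / ((k : ℝ) + 1) by positivity]
    · obtain ⟨k, hk⟩ := exists_nat_one_div_lt (sub_pos.2 hs)
      exact ⟨k, by linarith⟩
  have hT := tendsto_measure_iUnion_atTop (μ := φ.1) hmono
  rw [hU] at hT
  refine le_of_tendsto' hT fun k => ?_
  obtain ⟨m, hm⟩ := exists_measure_Ioc_eq φ 0 (t - 1 / ((k : ℝ) + 1))
  have hnot : ¬ (n : ℝ≥0∞) ≤ φ.1 (Ioc 0 (t - 1 / ((k : ℝ) + 1))) := by
    rw [le_measure_Ioc_iff h hn, not_le]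
    linarith [show 0 < 1 / ((k : ℝ) + 1) by positivity]
  rw [hm] at hnot
  simp only [Function.comp, hm]
  have : ¬ n ≤ m := fun hc => hnot (by exact_mod_cast hc)
  exact_mod_cast (by omega : m ≤ n - 1)

theorem measure_Ioc_τ_le (h : φ ∈ Minf) {n : ℕ} (hn : 1 ≤ n) :
    φ.1 (Ioc 0 (τ φ n)) ≤ (n - 1 : ℕ) + φ.1 {τ φ n} := by
  rw [← Ioo_union_right (τ_pos h hn)]
  exact (measure_union_le _ _).trans (add_le_add (measure_Ioo_τ_le h hn) le_rfl)

theorem measure_Ioc_τ (h : φ ∈ Minf) {n : ℕ} (hn : 1 ≤ n) : φ.1 (Ioc 0 (τ φ n)) = n := by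
  refine le_antisymm ?_ ((le_measure_Ioc_iff h hn _).2 le_rfl)
  calc φ.1 (Ioc 0 (τ φ n)) ≤ (n - 1 : ℕ) + 1 :=
        (measure_Ioc_τ_le h hn).trans (add_le_add le_rfl (h.1.2 _))
    _ = n := by exact_mod_cast (by omega : n - 1 + 1 = n)

theorem one_le_measure_singleton_τ (h : φ ∈ Minf) {n : ℕ} (hn : 1 ≤ n) : 1 ≤ φ.1 {τ φ n} := by
  have h1 := measure_Ioc_τ_le h hn
  rw [measure_Ioc_τ h hn] at h1
  by_contra hc
  have h2 : ((n - 1 : ℕ) : ℝ≥0∞) + φ.1 {τ φ n} < (n - 1 : ℕ) + 1 :=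
    ENNReal.add_lt_add_left (ENNReal.natCast_ne_top _) (not_le.1 hc)
  have h3 : ((n - 1 : ℕ) : ℝ≥0∞) + 1 = n := by exact_mod_cast (by omega : n - 1 + 1 = n)
  rw [h3] at h2
  exact absurd h1 (not_le.2 h2)

/-- Restarting at the `n`-th point moves the `k`-th later point to `τ φ (n + k) - τ φ n`. -/
theorem τ_θ_τ (h : φ ∈ Minf) {n k : ℕ} (hn : 1 ≤ n) (hk : 1 ≤ k) :
    τ (θ (τ φ n) φ) k = τ φ (n + k) - τ φ n := by
  have hθ := θ_mem_Minf h (τ φ n)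
  have hcount : ∀ t, (k : ℝ≥0∞) ≤ (θ (τ φ n) φ).1 (Ioc 0 t) ↔ τ φ (n + k) ≤ τ φ n + t := fun t => by
    rcases lt_or_ge 0 t with ht | ht
    · rw [θ_apply _ _ measurableSet_Ioc, ← le_measure_Ioc_iff h (by omega)]
      have hpre : (fun s => s - τ φ n) ⁻¹' Ioc 0 t = Ioc (τ φ n) (τ φ n + t) := by
        ext s
        simp only [mem_preimage, mem_Ioc, sub_pos, sub_le_iff_le_add']
      have hsplit : φ.1 (Ioc 0 (τ φ n + t)) = n + φ.1 (Ioc (τ φ n) (τ φ n + t)) := by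
        rw [← measure_Ioc_τ h hn, ← Ioc_union_Ioc_eq_Ioc (τ_pos h hn).le (by linarith),
          measure_union (Ioc_disjoint_Ioc_of_le le_rfl) measurableSet_Ioc]
      rw [hpre, hsplit]
      push_cast
      exact (ENNReal.add_le_add_iff_left (ENNReal.natCast_ne_top n)).symm
    · constructor
      · intro hle
        rw [Ioc_eq_empty (not_lt.2 ht), measure_empty] at hle
        simp at hle
        omega
      · intro hle
        have h1 := (le_measure_Ioc_iff h (by omega : 1 ≤ n + k) (τ φ n)).2 (by linarith)
        rw [measure_Ioc_τ h hn] at h1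
        have : n + k ≤ n := by exact_mod_cast h1
        omega
  refine le_antisymm ?_ ?_
  · rw [← le_measure_Ioc_iff hθ hk, hcount]
    linarith
  · have := (hcount (τ (θ (τ φ n) φ) k)).1 ((le_measure_Ioc_iff hθ hk _).2 le_rfl)
    linarith

theorem T_zero_θ_τ (h : φ ∈ Minf) {n : ℕ} (hn : 1 ≤ n) : T 0 (θ (τ φ n) φ) = 0 := by
  simp only [T, lt_irrefl, if_false]
  refine IsLUB.sSup_eq (IsGreatest.isLUB ⟨⟨0, ⟨le_rfl, ?_⟩, by simp⟩, ?_⟩)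
  · have hpre : (fun s => s - τ φ n) ⁻¹' Icc 0 0 = {τ φ n} := by
      ext s; simp [sub_eq_zero]
    rw [θ_apply _ _ measurableSet_Icc, hpre]
    simpa using one_le_measure_singleton_τ h hn
  · rintro _ ⟨t, ⟨ht, -⟩, rfl⟩
    exact EReal.coe_nonpos.2 ht

theorem tendsto_τ (h : φ ∈ Minf) : Tendsto (τ φ) atTop atTop := by
  refine tendsto_atTop.2 fun b => ?_
  obtain ⟨k, hk⟩ := exists_measure_Ioc_eq φ 0 b
  filter_upwards [eventually_gt_atTop k] with n hn
  by_contra hc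
  have h1 := (le_measure_Ioc_iff h (by omega : 1 ≤ n) b).2 (not_le.1 hc).le
  rw [hk] at h1
  have : n ≤ k := by exact_mod_cast h1
  omega

theorem mem_F (h : φ ∈ Minf) {n : ℕ} (hn : 1 ≤ n) : φ ∈ F n := by
  refine ⟨h.1, ?_, ?_⟩ <;> rw [T_eq_τ h hn] <;> simp

/-- The event-shift to the first positive point, as a self-map of `M^∞`. -/
noncomputable def S (φ : Minf) : Minf := ⟨η 1 φ.1, θ_mem_Minf φ.2 _⟩

theorem measurable_S : Measurable S :=
  ((measurable_η 1).comp measurable_subtype_coe).subtype_mk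

theorem S_iterate (φ : Minf) {n : ℕ} (hn : 1 ≤ n) : (S^[n] φ).1 = η n φ.1 := by
  induction n, hn using Nat.le_induction with
  | base => rfl
  | succ n hn ih =>
    rw [Function.iterate_succ_apply']
    change η 1 (S^[n] φ).1 = _
    rw [ih]
    have h1 : (T 1 (θ (τ φ.1 n) φ.1)).toReal = τ φ.1 (n + 1) - τ φ.1 n := by
      have := τ_θ_τ φ.2 hn le_rfl
      simpa [τ] using this
    change θ (T 1 (θ (τ φ.1 n) φ.1)).toReal (θ (τ φ.1 n) φ.1) = θ (τ φ.1 (n + 1)) φ.1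
    rw [h1, θ_θ]
    congr 1
    ring

theorem α_zero_S_iterate (φ : Minf) {n : ℕ} (hn : 1 ≤ n) :
    α 0 (S^[n] φ).1 = τ φ.1 (n + 1) - τ φ.1 n := by
  rw [S_iterate φ hn, α]
  change (T (0 + 1) (θ (τ φ.1 n) φ.1)).toReal - (T 0 (θ (τ φ.1 n) φ.1)).toReal = _
  rw [T_zero_θ_τ φ.2 hn]
  have := τ_θ_τ φ.2 hn le_rfl
  simpa [τ] using this

theorem sum_α_zero (φ : Minf) (n : ℕ) :
    ∑ i ∈ Finset.Icc 1 n, α 0 (S^[i] φ).1 = τ φ.1 (n + 1) - τ φ.1 1 := by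
  induction n with
  | zero => simp
  | succ n ih =>
    rw [Finset.sum_Icc_succ_top (by omega), ih, α_zero_S_iterate φ (by omega)]
    ring

theorem T_nonpos_le (φ : E) {n : ℤ} (hn : ¬ 0 < n) : T n φ ≤ 0 := by
  simp only [T, if_neg hn]
  refine sSup_le ?_
  rintro _ ⟨t, ⟨ht, -⟩, rfl⟩
  exact EReal.coe_nonpos.2 ht

theorem α_zero_pos (φ : Minf) : 0 < α 0 φ.1 := by
  have h1 : 0 < (T (0 + 1) φ.1).toReal := τ_pos φ.2 le_rfl
  have h2 : (T 0 φ.1).toReal ≤ 0 := by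
    exact EReal.toReal_nonpos (T_nonpos_le φ.1 (lt_irrefl _))
  rw [α]
  linarith

theorem mem_ηInv_iff (φ : Minf) {n : ℕ} (hn : 1 ≤ n) (A : Set E) :
    φ.1 ∈ ηInv n A ↔ (S^[n] φ).1 ∈ A := by
  rw [S_iterate φ hn]
  exact and_iff_right (mem_F φ.2 hn)

/-- Invariance in the sense of `invariantField` is strict invariance under `S`. -/
theorem ηInv_one_image (A : Set Minf) :
    ηInv 1 (Subtype.val '' A) = Subtype.val '' (S ⁻¹' A) := by
  ext φ
  constructor
  · rintro ⟨-, ψ, hψ, hη⟩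
    have hm : φ ∈ Minf := by
      have h1 := θ_mem_Minf ψ.2 (-(T 1 φ).toReal)
      rw [hη, η, θ_neg_θ] at h1
      exact h1
    refine ⟨⟨φ, hm⟩, ?_, rfl⟩
    have : S ⟨φ, hm⟩ = ψ := Subtype.ext hη.symm
    rwa [mem_preimage, this]
  · rintro ⟨ψ, hψ, rfl⟩
    exact ⟨mem_F_one_of_mem_Minf ψ.2, S ψ, hψ, rfl⟩

theorem measurableSet_invariantField_iff (A : Set Minf) :
    MeasurableSet[invariantField] A ↔ MeasurableSet A ∧ S ⁻¹' A = A := by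
  change MeasurableSet A ∧ ηInv 1 (Subtype.val '' A) = Subtype.val '' A ↔ _
  rw [ηInv_one_image, Subtype.val_injective.image_injective.eq_iff]

theorem invariantField_le : invariantField ≤ (inferInstance : MeasurableSpace Minf) := fun A hA =>
  ((measurableSet_invariantField_iff A).1 hA).1

end PointProcess

/-! ### Event averages -/

namespace PointProcess

/-- The law `P` regarded as a measure on `M^∞`. -/
noncomputable def toMinf (P : Measure E) : Measure Minf := P.comap Subtype.val

section Transfer

variable {P : Measure E} [IsProbabilityMeasure P]

theorem ae_mem_Minf (hinf : P Minf = 1) : ∀ᵐ φ ∂P, φ ∈ Minf :=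
  (mem_ae_iff_prob_eq_one measurableSet_Minf).2 hinf

theorem ae_toMinf_iff (hinf : P Minf = 1) (p : E → Prop) :
    (∀ᵐ φ ∂P, p φ) ↔ ∀ᵐ φ ∂(toMinf P), p φ.1 := by
  rw [toMinf, ← ae_restrict_iff_subtype measurableSet_Minf,
    Measure.restrict_eq_self_of_ae_mem (ae_mem_Minf hinf)]

theorem toMinf_preimage (hinf : P Minf = 1) (B : Set E) :
    toMinf P (Subtype.val ⁻¹' B) = P B := by
  rw [toMinf, comap_subtype_coe_apply measurableSet_Minf, Subtype.image_preimage_coe]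
  refine measure_congr ?_
  filter_upwards [ae_mem_Minf hinf] with φ hφ
  exact propext (and_iff_right hφ)

theorem toMinf_real_preimage (hinf : P Minf = 1) (B : Set E) :
    (toMinf P).real (Subtype.val ⁻¹' B) = P.real B := by
  rw [measureReal_def, toMinf_preimage hinf, measureReal_def]

theorem isProbabilityMeasure_toMinf (hinf : P Minf = 1) : IsProbabilityMeasure (toMinf P) :=
  ⟨by rw [← preimage_univ, toMinf_preimage hinf, measure_univ]⟩

theorem forall_subset_Minf_iff {p : Set Minf → Prop} :
    (∀ A : Set E, MeasurableSet A → A ⊆ Minf → p (Subtype.val ⁻¹' A)) ↔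
      ∀ A : Set Minf, MeasurableSet A → p A := by
  refine ⟨fun h A hA => ?_, fun h A hA _ => h _ (measurable_subtype_coe hA)⟩
  have := h (Subtype.val '' A) (measurableSet_Minf.subtype_image hA) (Subtype.coe_image_subset _ _)
  rwa [Subtype.val_injective.preimage_image] at this

theorem preimage_ηInv {i : ℕ} (hi : 1 ≤ i) (A : Set E) :
    (Subtype.val ⁻¹' ηInv (i : ℤ) A : Set Minf) = S^[i] ⁻¹' (Subtype.val ⁻¹' A) := by
  ext φ
  exact mem_ηInv_iff φ hi A

theorem isEAMSWith_iff (hinf : P Minf = 1) (Pes : Measure Minf) :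
    IsEAMSWith P Pes ↔ IsProbabilityMeasure Pes ∧ IsAMSWith S (toMinf P) Pes := by
  rw [IsEAMSWith, and_iff_right hinf]
  refine and_congr_right fun _ => ?_
  rw [IsAMSWith, ← forall_subset_Minf_iff]
  refine forall_congr' fun A => forall_congr' fun _ => forall_congr' fun _ => ?_
  refine iff_of_eq (congrArg (Tendsto · _ _) (funext fun n => ?_))
  congr 1
  refine Finset.sum_congr rfl fun i hi => ?_
  rw [← preimage_ηInv (Finset.mem_Icc.1 hi).1, toMinf_real_preimage hinf]

theorem indicator_ηInv (φ : Minf) {i : ℕ} (hi : 1 ≤ i) (A : Set E) :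
    (ηInv (i : ℤ) A).indicator (fun _ => (1 : ℝ)) φ.1 =
      (Subtype.val ⁻¹' A : Set Minf).indicator (fun _ => (1 : ℝ)) (S^[i] φ) := by
  classical
  simp only [indicator_apply, mem_preimage, mem_ηInv_iff φ hi A]

theorem isEAMS_iff (hinf : P Minf = 1) :
    IsEAMS P ↔ ∀ A : Set E, MeasurableSet A → A ⊆ Minf → ∀ᵐ φ ∂P, ∃ l : ℝ,
      Tendsto (fun n : ℕ => (1 / (n : ℝ)) *
        ∑ i ∈ Finset.Icc 1 n, (ηInv (i : ℤ) A).indicator (fun _ => (1 : ℝ)) φ) atTop (𝓝 l) := by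
  have := isProbabilityMeasure_toMinf hinf
  simp_rw [IsEAMS, isEAMSWith_iff hinf]
  rw [exists_isAMSWith_iff measurable_S, ← forall_subset_Minf_iff]
  refine forall_congr' fun A => forall_congr' fun _ => forall_congr' fun _ => ?_
  rw [ae_toMinf_iff hinf]
  refine iff_of_eq (congrArg (fun p : Minf → Prop => ∀ᵐ φ ∂(toMinf P), p φ) (funext fun φ => ?_))
  refine congrArg (fun u : ℕ → ℝ => ∃ l, Tendsto u atTop (𝓝 l)) (funext fun n => ?_)
  congr 1
  exact Finset.sum_congr rfl fun i hi => (indicator_ηInv φ (Finset.mem_Icc.1 hi).1 A).symm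

end Transfer

/-! ### Counting points in `(0, x]` -/

section Counting

variable {φ : E}

theorem N_eq_NA_univ (B : Set ℝ) (φ : E) : N B φ = NA univ B φ := by
  refine tsum_congr fun n => ?_
  congr 2
  ext ψ
  exact ⟨fun h => ⟨h.1, h.2, h.1, mem_univ _⟩, fun h => ⟨h.1, h.2.1⟩⟩

/-- The number of points in `(0, x]`. -/
noncomputable def count (φ : E) (x : ℝ) : ℕ := (exists_measure_Ioc_eq φ 0 x).choose

theorem le_count_iff (h : φ ∈ Minf) {n : ℕ} (hn : 1 ≤ n) (x : ℝ) : n ≤ count φ x ↔ τ φ n ≤ x := by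
  rw [← le_measure_Ioc_iff h hn, (exists_measure_Ioc_eq φ 0 x).choose_spec]
  exact_mod_cast Iff.rfl

theorem count_τ (h : φ ∈ Minf) {n : ℕ} (hn : 1 ≤ n) : count φ (τ φ n) = n := by
  have h1 : φ.1 (Ioc 0 (τ φ n)) = count φ (τ φ n) := (exists_measure_Ioc_eq φ 0 (τ φ n)).choose_spec
  exact_mod_cast h1.symm.trans (measure_Ioc_τ h hn)

theorem NA_Ioc (h : φ ∈ Minf) (A : Set E) (x : ℝ) :
    (NA A (Ioc 0 x) φ).toReal =
      ∑ i ∈ Finset.Icc 1 (count φ x), (ηInv (i : ℤ) A).indicator (fun _ => (1 : ℝ)) φ := by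
  classical
  have hsum : NA A (Ioc 0 x) φ =
      ∑ i ∈ Finset.Icc 1 (count φ x), (ηInv (i : ℤ) A).indicator (fun _ => (1 : ℝ≥0∞)) φ := by
    rw [NA, tsum_eq_sum (s := (Finset.Icc 1 (count φ x)).map Nat.castEmbedding), Finset.sum_map]
    · refine Finset.sum_congr rfl fun i hi => ?_
      obtain ⟨h1, h2⟩ := Finset.mem_Icc.1 hi
      rw [le_count_iff h h1] at h2
      simp only [indicator_apply, mem_ofPred_eq, Nat.castEmbedding_apply, Pi.one_apply]
      refine if_congr ⟨fun hφ => hφ.2.2, fun hφ => ⟨mem_F h h1, ⟨τ_pos h h1, h2⟩, hφ⟩⟩ rfl rfl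
    · intro n hn
      refine indicator_of_notMem (fun hφ => hn ?_) _
      obtain ⟨-, ⟨h1, h2⟩, -⟩ := hφ
      have hpos : 0 < n := by
        by_contra hc
        exact absurd h1 (not_lt.2 (EReal.toReal_nonpos (T_nonpos_le φ hc)))
      obtain ⟨m, rfl⟩ := Int.eq_ofNat_of_zero_le hpos.le
      have hm : 1 ≤ m := by omega
      exact Finset.mem_map.2 ⟨m, Finset.mem_Icc.2 ⟨hm, (le_count_iff h hm x).2 h2⟩, rfl⟩
  rw [hsum, ENNReal.toReal_sum fun i _ => ?_]
  · refine Finset.sum_congr rfl fun i _ => ?_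
    simp only [indicator_apply]
    split_ifs <;> simp
  · simp only [indicator_apply]
    split_ifs <;> simp

theorem N_Ioc (h : φ ∈ Minf) (x : ℝ) : (N (Ioc 0 x) φ).toReal = count φ x := by
  have hone : ∀ i ∈ Finset.Icc 1 (count φ x),
      (ηInv (i : ℤ) univ).indicator (fun _ => (1 : ℝ)) φ = 1 := fun i hi =>
    indicator_of_mem (s := ηInv (i : ℤ) univ)
      ⟨mem_F h (Finset.mem_Icc.1 hi).1, mem_univ _⟩ _
  rw [N_eq_NA_univ, NA_Ioc h, Finset.sum_congr rfl hone]
  simp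

theorem tendsto_count (h : φ ∈ Minf) : Tendsto (count φ) atTop atTop := by
  refine tendsto_atTop.2 fun n => ?_
  filter_upwards [eventually_ge_atTop (τ φ (n + 1))] with x hx
  exact (Nat.le_succ n).trans ((le_count_iff h (by omega) x).2 hx)

theorem tendsto_τ_succ_div_iff (φ : E) (c : ℝ) :
    Tendsto (fun n : ℕ => (1 / (n : ℝ)) * (τ φ (n + 1) - τ φ 1)) atTop (𝓝 c) ↔
      Tendsto (fun n : ℕ => τ φ n / n) atTop (𝓝 c) := by
  have h0 : Tendsto (fun n : ℕ => 1 / ((n : ℝ) + 1)) atTop (𝓝 0) :=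
    tendsto_one_div_add_atTop_nhds_zero_nat
  have h0' : Tendsto (fun n : ℕ => 1 / (n : ℝ)) atTop (𝓝 0) := tendsto_one_div_atTop_nhds_zero_nat
  rw [← tendsto_add_atTop_iff_nat (f := fun n : ℕ => τ φ n / n) 1]
  constructor
  · intro h
    have h1 : Tendsto (fun n : ℕ => (1 - 1 / ((n : ℝ) + 1)) *
        ((1 / (n : ℝ)) * (τ φ (n + 1) - τ φ 1)) + 1 / ((n : ℝ) + 1) * τ φ 1) atTop
        (𝓝 ((1 - 0) * c + 0 * τ φ 1)) :=
      ((tendsto_const_nhds.sub h0).mul h).add (h0.mul tendsto_const_nhds)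
    simp only [sub_zero, one_mul, zero_mul, add_zero] at h1
    refine h1.congr' ?_
    filter_upwards [eventually_gt_atTop 0] with n hn
    have : (n : ℝ) ≠ 0 := by positivity
    push_cast
    field_simp
    ring
  · intro h
    have h1 : Tendsto (fun n : ℕ => (1 + 1 / (n : ℝ)) *
        (τ φ (n + 1) / ((n + 1 : ℕ) : ℝ)) - 1 / (n : ℝ) * τ φ 1) atTop
        (𝓝 ((1 + 0) * c - 0 * τ φ 1)) :=
      ((tendsto_const_nhds.add h0').mul h).sub (h0'.mul tendsto_const_nhds)
    simp only [add_zero, one_mul, zero_mul, sub_zero] at h1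
    refine h1.congr' ?_
    filter_upwards [eventually_gt_atTop 0] with n hn
    have : (n : ℝ) ≠ 0 := by positivity
    push_cast
    field_simp

/-- If the `n`-th point grows like `c n`, then the number of points in `(0, x]` grows like
`x / c`. -/
theorem tendsto_count_div (h : φ ∈ Minf) {c : ℝ} (hc : 0 < c)
    (hτ : Tendsto (fun n : ℕ => τ φ n / n) atTop (𝓝 c)) :
    Tendsto (fun x : ℝ => (count φ x : ℝ) / x) atTop (𝓝 c⁻¹) := by
  have hk := tendsto_count h
  have hlow : Tendsto (fun x => τ φ (count φ x) / (count φ x : ℕ)) atTop (𝓝 c) := hτ.comp hk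
  have hup : Tendsto (fun x => τ φ (count φ x + 1) / ((count φ x + 1 : ℕ) : ℝ) *
      (1 + 1 / (count φ x : ℝ))) atTop (𝓝 c) := by
    have h1 := (hτ.comp (tendsto_add_atTop_nat 1)).comp hk
    have h2 := (tendsto_const_nhds (x := (1 : ℝ))).add
      (tendsto_one_div_atTop_nhds_zero_nat (𝕜 := ℝ) |>.comp hk)
    simpa using h1.mul h2
  have hmid : Tendsto (fun x : ℝ => x / (count φ x : ℝ)) atTop (𝓝 c) := by
    refine tendsto_of_tendsto_of_tendsto_of_le_of_le' hlow hup ?_ ?_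
    · filter_upwards [hk.eventually (eventually_ge_atTop 1)] with x hx
      exact div_le_div_of_nonneg_right ((le_count_iff h hx x).1 le_rfl) (Nat.cast_nonneg _)
    · filter_upwards [hk.eventually (eventually_ge_atTop 1)] with x hx
      have hlt : x < τ φ (count φ x + 1) := by
        rw [← not_le, ← le_count_iff h (by omega)]
        omega
      have hpos : (0 : ℝ) < count φ x := by exact_mod_cast hx
      calc x / (count φ x : ℝ) ≤ τ φ (count φ x + 1) / (count φ x : ℝ) :=
            div_le_div_of_nonneg_right hlt.le hpos.le
        _ = _ := by push_cast; field_simp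
  refine (hmid.inv₀ hc.ne').congr fun x => ?_
  rw [inv_div]

theorem tendsto_NA_of_tendsto_average (h : φ ∈ Minf) {c l : ℝ} (hc : 0 < c)
    (hτ : Tendsto (fun n : ℕ => τ φ n / n) atTop (𝓝 c)) {A : Set E}
    (hA : Tendsto (fun n : ℕ => (1 / (n : ℝ)) *
      ∑ i ∈ Finset.Icc 1 n, (ηInv (i : ℤ) A).indicator (fun _ => (1 : ℝ)) φ) atTop (𝓝 l)) :
    Tendsto (fun x : ℝ => (1 / x) * (NA A (Ioc 0 x) φ).toReal) atTop (𝓝 (c⁻¹ * l)) := by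
  refine ((tendsto_count_div h hc hτ).mul (hA.comp (tendsto_count h))).congr' ?_
  filter_upwards [(tendsto_count h).eventually (eventually_ge_atTop 1)] with x hx
  have hpos : (count φ x : ℝ) ≠ 0 := by
    have : 0 < count φ x := hx
    positivity
  rw [NA_Ioc h]
  simp only [Function.comp]
  field_simp

theorem tendsto_τ_div_of_tendsto_N (h : φ ∈ Minf) {r : ℝ} (hr : 0 < r)
    (hN : Tendsto (fun x : ℝ => (1 / x) * (N (Ioc 0 x) φ).toReal) atTop (𝓝 r)) :
    Tendsto (fun n : ℕ => τ φ n / n) atTop (𝓝 r⁻¹) := by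
  refine ((hN.comp (tendsto_τ h)).inv₀ hr.ne').congr' ?_
  filter_upwards [eventually_ge_atTop 1] with n hn
  simp only [Function.comp, N_Ioc h, count_τ h hn]
  rw [one_div, inv_mul_eq_div, inv_div]

theorem tendsto_average_of_tendsto_NA (h : φ ∈ Minf) {r l : ℝ} (hr : 0 < r)
    (hN : Tendsto (fun x : ℝ => (1 / x) * (N (Ioc 0 x) φ).toReal) atTop (𝓝 r)) {A : Set E}
    (hA : Tendsto (fun x : ℝ => (1 / x) * (NA A (Ioc 0 x) φ).toReal) atTop (𝓝 l)) :
    Tendsto (fun n : ℕ => (1 / (n : ℝ)) *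
      ∑ i ∈ Finset.Icc 1 n, (ηInv (i : ℤ) A).indicator (fun _ => (1 : ℝ)) φ) atTop
      (𝓝 (r⁻¹ * l)) := by
  refine ((tendsto_τ_div_of_tendsto_N h hr hN).mul (hA.comp (tendsto_τ h))).congr' ?_
  filter_upwards [eventually_ge_atTop 1] with n hn
  have hpos : (n : ℝ) ≠ 0 := by positivity
  have ht := (τ_pos h hn).ne'
  simp only [Function.comp, NA_Ioc h, count_τ h hn]
  field_simp

theorem birkhoffSum_α_S (φ : Minf) (n : ℕ) :
    birkhoffSum S (fun ψ : Minf => α 0 ψ.1) n (S φ) = τ φ.1 (n + 1) - τ φ.1 1 := by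
  rw [← sum_Icc_one_eq_birkhoffSum, sum_α_zero]

/-- The ergodic averages of the gap `α 0` and the rates `τ φ n / n` have the same limits. -/
theorem tendsto_birkhoffSum_α_iff (φ : Minf) (c : ℝ) :
    Tendsto (fun n : ℕ => (1 / (n : ℝ)) * birkhoffSum S (fun ψ : Minf => α 0 ψ.1) n φ) atTop (𝓝 c) ↔
      Tendsto (fun n : ℕ => τ φ.1 n / n) atTop (𝓝 c) := by
  rw [← tendsto_birkhoffSum_div_apply_iff, ← tendsto_τ_succ_div_iff]
  simp_rw [birkhoffSum_α_S]

end Counting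

end PointProcess

/-! ### The conditional mean gap -/

namespace PointProcess

section Gap

/-- The gap `α 0` on `M^∞`. -/
noncomputable def gap (φ : Minf) : ℝ := α 0 φ.1

theorem measurable_gap : Measurable gap := (measurable_α 0).comp measurable_subtype_coe

theorem gap_pos (φ : Minf) : 0 < gap φ := α_zero_pos φ

variable {Q : Measure Minf}

theorem measurable_condMeanGap : Measurable[invariantField] (condMeanGap Q) :=
  measurable_condLExp _ _ _

theorem invariant_condMeanGap_preimage {B : Set ℝ≥0∞} (hB : MeasurableSet B) :
    MeasurableSet (condMeanGap Q ⁻¹' B) ∧ S ⁻¹' (condMeanGap Q ⁻¹' B) = condMeanGap Q ⁻¹' B :=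
  (measurableSet_invariantField_iff _).1 (measurable_condMeanGap hB)

variable [IsProbabilityMeasure Q]

theorem setLIntegral_condMeanGap {D : Set Minf} (hD : MeasurableSet[invariantField] D) :
    ∫⁻ φ in D, condMeanGap Q φ ∂Q = ∫⁻ φ in D, ENNReal.ofReal (gap φ) ∂Q :=
  setLIntegral_condLExp invariantField_le Q _ hD

theorem ae_condMeanGap_pos : ∀ᵐ φ ∂Q, 0 < condMeanGap Q φ := by
  have hD := measurable_condMeanGap (Q := Q) (measurableSet_singleton (0 : ℝ≥0∞))
  have hDm := (invariant_condMeanGap_preimage (Q := Q) (measurableSet_singleton (0 : ℝ≥0∞))).1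
  have h1 := setLIntegral_condMeanGap (Q := Q) hD
  rw [setLIntegral_congr_fun (g := fun _ => 0) hDm fun φ hφ => hφ, lintegral_zero, eq_comm,
    setLIntegral_eq_zero_iff hDm measurable_gap.ennreal_ofReal] at h1
  filter_upwards [h1] with φ hφ
  rw [pos_iff_ne_zero]
  intro h0
  have := hφ h0
  rw [ENNReal.ofReal_eq_zero] at this
  exact absurd (gap_pos φ) (not_lt.2 this)

/-- Birkhoff's theorem for the gap: it is integrable on each of the invariant events
`{condMeanGap Q ≤ k}`, although possibly not on the whole space. -/
theorem ae_exists_pos_tendsto_gap (hS : MeasurePreserving S Q Q)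
    (hfin : ∀ᵐ φ ∂Q, condMeanGap Q φ < ∞) :
    ∀ᵐ φ ∂Q, ∃ l : ℝ, 0 < l ∧
      Tendsto (fun n : ℕ => (1 / (n : ℝ)) * birkhoffSum S gap n φ) atTop (𝓝 l) := by
  have hk : ∀ k : ℕ, ∀ᵐ φ ∂Q, condMeanGap Q φ ≤ k → ∃ l : ℝ,
      Tendsto (fun n : ℕ => (1 / (n : ℝ)) * birkhoffSum S gap n φ) atTop (𝓝 l) := fun k => by
    set D : Set Minf := condMeanGap Q ⁻¹' Iic (k : ℝ≥0∞) with hDdef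
    have hD : MeasurableSet[invariantField] D := measurable_condMeanGap measurableSet_Iic
    obtain ⟨hDm, hinv⟩ := invariant_condMeanGap_preimage (Q := Q) (measurableSet_Iic (a := (k : ℝ≥0∞)))
    have hint : Integrable (D.indicator gap) Q := by
      rw [integrable_indicator_iff hDm]
      refine ⟨measurable_gap.aestronglyMeasurable, ?_⟩
      rw [hasFiniteIntegral_iff_ofReal (ae_of_all _ fun φ => (gap_pos φ).le),
        ← setLIntegral_condMeanGap hD]
      calc ∫⁻ φ in D, condMeanGap Q φ ∂Q ≤ ∫⁻ _ in D, (k : ℝ≥0∞) ∂Q :=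
            setLIntegral_mono' hDm fun φ hφ => hφ
        _ < ∞ := by
            rw [setLIntegral_const]
            exact ENNReal.mul_lt_top (ENNReal.natCast_lt_top k) (measure_lt_top _ _)
    filter_upwards [ae_exists_tendsto_birkhoffSum_div hS (measurable_gap.indicator hDm) hint
      fun φ => indicator_nonneg (fun ψ _ => (gap_pos ψ).le) φ] with φ ⟨l, hl⟩ hφ
    refine ⟨l, hl.congr fun n => ?_⟩
    have hmem : ∀ i, S^[i] φ ∈ D := fun i => by
      induction i with
      | zero => exact hφ
      | succ i ih =>
        rw [Function.iterate_succ_apply']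
        exact (Set.ext_iff.1 hinv _).2 ih
    congr 1
    exact Finset.sum_congr rfl fun i _ => indicator_of_mem (hmem i) _
  filter_upwards [hfin, ae_all_iff.2 hk, ae_not_tendsto_birkhoffSum_zero hS measurable_gap gap_pos]
    with φ h1 h2 h3
  obtain ⟨k, hk⟩ := ENNReal.exists_nat_gt h1.ne
  obtain ⟨l, hl⟩ := h2 k hk.le
  have hl0 : 0 ≤ l := ge_of_tendsto' hl fun n =>
    mul_nonneg (by positivity) (Finset.sum_nonneg fun i _ => (gap_pos _).le)
  refine ⟨l, lt_of_le_of_ne hl0 ?_, hl⟩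
  rintro rfl
  exact h3 hl

theorem measurableSet_exists_pos_tendsto_gap : MeasurableSet {φ : Minf | ∃ l : ℝ, 0 < l ∧
    Tendsto (fun n : ℕ => (1 / (n : ℝ)) * birkhoffSum S gap n φ) atTop (𝓝 l)} := by
  have hm : ∀ n : ℕ, Measurable fun φ : Minf => (1 / (n : ℝ)) * birkhoffSum S gap n φ := fun n =>
    (measurable_birkhoffSum measurable_S measurable_gap n).const_mul _
  have : {φ : Minf | ∃ l : ℝ, 0 < l ∧
      Tendsto (fun n : ℕ => (1 / (n : ℝ)) * birkhoffSum S gap n φ) atTop (𝓝 l)} =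
      {φ | ∃ l : ℝ, Tendsto (fun n : ℕ => (1 / (n : ℝ)) * birkhoffSum S gap n φ) atTop (𝓝 l)} \
      {φ | Tendsto (fun n : ℕ => (1 / (n : ℝ)) * birkhoffSum S gap n φ) atTop (𝓝 0)} := by
    ext φ
    constructor
    · rintro ⟨l, hl0, hl⟩
      exact ⟨⟨l, hl⟩, fun h0 => hl0.ne' (tendsto_nhds_unique hl h0)⟩
    · rintro ⟨⟨l, hl⟩, h0⟩
      have hl0 : 0 ≤ l := ge_of_tendsto' hl fun n =>
        mul_nonneg (by positivity) (Finset.sum_nonneg fun i _ => (gap_pos _).le)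
      refine ⟨l, lt_of_le_of_ne hl0 ?_, hl⟩
      rintro rfl
      exact h0 hl
  rw [this]
  exact (measurableSet_exists_tendsto_birkhoffSum measurable_S measurable_gap).diff
    (measurableSet_tendsto _ hm)

theorem ae_exists_pos_tendsto_gap_iff {P : Measure Minf} [IsProbabilityMeasure P]
    (h : IsAMSWith S P Q) :
    (∀ᵐ φ ∂P, ∃ l : ℝ, 0 < l ∧
      Tendsto (fun n : ℕ => (1 / (n : ℝ)) * birkhoffSum S gap n φ) atTop (𝓝 l)) ↔
    ∀ᵐ φ ∂Q, ∃ l : ℝ, 0 < l ∧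
      Tendsto (fun n : ℕ => (1 / (n : ℝ)) * birkhoffSum S gap n φ) atTop (𝓝 l) := by
  refine h.ae_mem_iff measurableSet_exists_pos_tendsto_gap (Set.ext fun φ => ?_)
  exact exists_congr fun l => and_congr_right fun _ =>
    tendsto_birkhoffSum_div_apply_iff S gap φ l

theorem ae_condMeanGap_lt_top (hS : MeasurePreserving S Q Q)
    (h : ∀ᵐ φ ∂Q, ∃ l : ℝ,
      Tendsto (fun n : ℕ => (1 / (n : ℝ)) * birkhoffSum S gap n φ) atTop (𝓝 l)) :
    ∀ᵐ φ ∂Q, condMeanGap Q φ < ∞ := by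
  set L : Minf → ℝ := fun φ =>
    limsup (fun n : ℕ => (1 / (n : ℝ)) * birkhoffSum S gap n φ) atTop with hL
  have hLm : Measurable L := Measurable.limsup fun n =>
    (measurable_birkhoffSum measurable_S measurable_gap n).const_mul _
  -- On the invariant event where `condMeanGap Q = ∞` and the averages have a limit `≤ k`, the
  -- integral of the gap is at most `k`.
  have hk : ∀ k : ℕ, ∀ᵐ φ ∂Q, ¬ (condMeanGap Q φ = ∞ ∧
      (∃ l : ℝ, Tendsto (fun n : ℕ => (1 / (n : ℝ)) * birkhoffSum S gap n φ) atTop (𝓝 l)) ∧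
      L φ ≤ k) := fun k => by
    set C : Set Minf :=
      {φ | ∃ l : ℝ, Tendsto (fun n : ℕ => (1 / (n : ℝ)) * birkhoffSum S gap n φ) atTop (𝓝 l)}
    have hC : MeasurableSet C := measurableSet_exists_tendsto_birkhoffSum measurable_S measurable_gap
    set D : Set Minf := condMeanGap Q ⁻¹' {∞} ∩ (C ∩ {φ | L φ ≤ k}) with hDdef
    obtain ⟨htm, htinv⟩ := invariant_condMeanGap_preimage (Q := Q) (measurableSet_singleton ∞)
    have hDm : MeasurableSet D := htm.inter (hC.inter (hLm measurableSet_Iic))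
    have hinvC : S ⁻¹' (C ∩ {φ | L φ ≤ k}) = C ∩ {φ | L φ ≤ k} := by
      ext φ
      constructor
      · rintro ⟨⟨l, hl⟩, hle⟩
        have hl' := (tendsto_birkhoffSum_div_apply_iff S gap φ l).1 hl
        refine ⟨⟨l, hl'⟩, ?_⟩
        have hle' : L (S φ) ≤ k := hle
        simp only [hL, hl.limsup_eq] at hle'
        simpa only [mem_ofPred_eq, hL, hl'.limsup_eq] using hle'
      · rintro ⟨⟨l, hl⟩, hle⟩
        have hl' := (tendsto_birkhoffSum_div_apply_iff S gap φ l).2 hl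
        refine ⟨⟨l, hl'⟩, ?_⟩
        have hle' : L φ ≤ k := hle
        simp only [hL, hl.limsup_eq] at hle'
        simpa only [mem_ofPred_eq, hL, hl'.limsup_eq] using hle'
    have hinv : S ⁻¹' D = D := by rw [hDdef, preimage_inter, htinv, hinvC]
    have hD : MeasurableSet[invariantField] D := (measurableSet_invariantField_iff D).2 ⟨hDm, hinv⟩
    have h1 : ∫⁻ φ in D, ENNReal.ofReal (gap φ) ∂Q ≤ ∫⁻ φ in D, ENNReal.ofReal (L φ) ∂Q := by
      refine setLIntegral_le_of_tendsto_birkhoffSum hS measurable_gap (fun φ => (gap_pos φ).le)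
        hDm hinv (ae_of_all _ fun φ hφ => ?_)
      obtain ⟨l, hl⟩ := hφ.2.1
      simpa only [hL, hl.limsup_eq] using hl
    rw [← setLIntegral_condMeanGap hD] at h1
    have h2 : ∫⁻ φ in D, ENNReal.ofReal (L φ) ∂Q ≤ ∫⁻ _ in D, (k : ℝ≥0∞) ∂Q :=
      setLIntegral_mono' hDm fun φ hφ => by
        rw [← ENNReal.ofReal_natCast]
        exact ENNReal.ofReal_le_ofReal hφ.2.2
    have h3 : ∫⁻ φ in D, condMeanGap Q φ ∂Q = ∞ * Q D := by
      rw [← setLIntegral_const]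
      exact setLIntegral_congr_fun hDm fun φ hφ => hφ.1
    rw [setLIntegral_const] at h2
    have h4 : ∞ * Q D < ∞ := by
      rw [← h3]
      exact (h1.trans h2).trans_lt
        (ENNReal.mul_lt_top (ENNReal.natCast_lt_top k) (measure_lt_top _ _))
    have h5 : Q D = 0 := by
      by_contra hne
      rw [ENNReal.top_mul hne] at h4
      exact lt_irrefl _ h4
    exact measure_eq_zero_iff_ae_notMem.1 h5
  filter_upwards [h, ae_all_iff.2 hk] with φ h1 h2
  rw [lt_top_iff_ne_top]
  intro ht
  obtain ⟨k, hk⟩ := exists_nat_ge (L φ)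
  exact h2 k ⟨ht, h1, hk⟩

end Gap

section Rates

variable {P : Measure E} [IsProbabilityMeasure P]

theorem isEAMS_condMeanGap_iff (hinf : P Minf = 1) :
    (∃ Pes : Measure Minf, IsEAMSWith P Pes ∧
        ∀ᵐ φ ∂Pes, 0 < condMeanGap Pes φ ∧ condMeanGap Pes φ < ∞) ↔
      (∀ A : Set E, MeasurableSet A → A ⊆ Minf → ∀ᵐ φ ∂P, ∃ l : ℝ,
        Tendsto (fun x : ℝ => (1 / x) * (NA A (Ioc 0 x) φ).toReal) atTop (𝓝 l)) ∧
      (∀ᵐ φ ∂P, ∃ l : ℝ, 0 < l ∧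
        Tendsto (fun x : ℝ => (1 / x) * (N (Ioc 0 x) φ).toReal) atTop (𝓝 l)) := by
  have := isProbabilityMeasure_toMinf hinf
  constructor
  · rintro ⟨Q, hQ, hgap⟩
    obtain ⟨hQp, hams⟩ := (isEAMSWith_iff hinf Q).1 hQ
    have hrate : ∀ᵐ φ ∂P, ∃ c : ℝ, 0 < c ∧ Tendsto (fun n : ℕ => τ φ n / n) atTop (𝓝 c) := by
      rw [ae_toMinf_iff hinf]
      filter_upwards [(ae_exists_pos_tendsto_gap_iff hams).2 (ae_exists_pos_tendsto_gap
        (hams.measurePreserving measurable_S) (hgap.mono fun _ h => h.2))] with φ ⟨c, hc, hφ⟩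
      exact ⟨c, hc, (tendsto_birkhoffSum_α_iff φ c).1 hφ⟩
    constructor
    · intro A hA hAsub
      filter_upwards [ae_mem_Minf hinf, hrate, (isEAMS_iff hinf).1 ⟨Q, hQ⟩ A hA hAsub]
        with φ hφ ⟨c, hc, hτ⟩ ⟨l, hl⟩
      exact ⟨_, tendsto_NA_of_tendsto_average hφ hc hτ hl⟩
    · filter_upwards [ae_mem_Minf hinf, hrate] with φ hφ ⟨c, hc, hτ⟩
      refine ⟨c⁻¹, inv_pos.2 hc, (tendsto_count_div hφ hc hτ).congr fun x => ?_⟩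
      rw [N_Ioc hφ, one_div, inv_mul_eq_div]
  · rintro ⟨hNA, hN⟩
    obtain ⟨Q, hQ⟩ := (isEAMS_iff hinf).2 fun A hA hAsub => by
      filter_upwards [ae_mem_Minf hinf, hN, hNA A hA hAsub] with φ hφ ⟨r, hr, h1⟩ ⟨l, hl⟩
      exact ⟨_, tendsto_average_of_tendsto_NA hφ hr h1 hl⟩
    obtain ⟨hQp, hams⟩ := (isEAMSWith_iff hinf Q).1 hQ
    have hlim : ∀ᵐ φ ∂Q, ∃ l : ℝ, 0 < l ∧
        Tendsto (fun n : ℕ => (1 / (n : ℝ)) * birkhoffSum S gap n φ) atTop (𝓝 l) := by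
      rw [← ae_exists_pos_tendsto_gap_iff hams]
      filter_upwards [(ae_toMinf_iff hinf _).1 hN] with φ ⟨r, hr, h1⟩
      exact ⟨r⁻¹, inv_pos.2 hr,
        (tendsto_birkhoffSum_α_iff φ _).2 (tendsto_τ_div_of_tendsto_N φ.2 hr h1)⟩
    refine ⟨Q, hQ, ?_⟩
    filter_upwards [ae_condMeanGap_pos, ae_condMeanGap_lt_top (hams.measurePreserving measurable_S)
      (hlim.mono fun φ ⟨l, _, hl⟩ => ⟨l, hl⟩)] with φ h1 h2
    exact ⟨h1, h2⟩

end Rates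

end PointProcess

/-! ### Time averages -/

section TimeAverages

variable {u : ℝ → ℝ}

theorem intervalIntegrable_of_abs_le_one (hu : Measurable u) (hb : ∀ y, |u y| ≤ 1) (a b : ℝ) :
    IntervalIntegrable u volume a b :=
  (intervalIntegrable_const (c := (1 : ℝ))).mono_fun hu.aestronglyMeasurable
    (ae_of_all _ fun y => by simpa using hb y)

theorem abs_intervalIntegral_le (hb : ∀ y, |u y| ≤ 1) (a b : ℝ) :
    |∫ y in a..b, u y| ≤ |b - a| := by
  simpa using intervalIntegral.norm_integral_le_of_norm_le_const (f := u) (C := 1)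
    fun y (_ : y ∈ uIoc a b) => hb y

theorem tendsto_div_zero_of_abs_le {v : ℝ → ℝ} {C : ℝ} (hv : ∀ᶠ x in atTop, |v x| ≤ C) :
    Tendsto (fun x : ℝ => (1 / x) * v x) atTop (𝓝 0) := by
  have h0 : Tendsto (fun x : ℝ => (1 / x) * C) atTop (𝓝 0) := by
    simpa using (tendsto_inv_atTop_zero (𝕜 := ℝ)).mul_const C
  refine squeeze_zero_norm' ?_ h0
  filter_upwards [hv, eventually_gt_atTop 0] with x hx hx0
  rw [norm_mul, Real.norm_of_nonneg (by positivity)]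
  exact mul_le_mul_of_nonneg_left hx (by positivity)

/-- Time averages of a bounded function converge as soon as they converge along the integers. -/
theorem tendsto_timeAverage_iff_nat (hu : Measurable u) (hb : ∀ y, |u y| ≤ 1) (l : ℝ) :
    Tendsto (fun x : ℝ => (1 / x) * ∫ y in (0 : ℝ)..x, u y) atTop (𝓝 l) ↔
      Tendsto (fun n : ℕ => (1 / (n : ℝ)) * ∫ y in (0 : ℝ)..n, u y) atTop (𝓝 l) := by
  refine ⟨fun h => h.comp tendsto_natCast_atTop_atTop, fun h => ?_⟩
  have h1 := (tendsto_nat_floor_div_atTop (R := ℝ)).mul (h.comp tendsto_nat_floor_atTop)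
  have h2 : Tendsto (fun x : ℝ => (1 / x) * ∫ y in (⌊x⌋₊ : ℝ)..x, u y) atTop (𝓝 0) := by
    refine tendsto_div_zero_of_abs_le (C := 1) ?_
    filter_upwards [eventually_ge_atTop 0] with x hx
    refine (abs_intervalIntegral_le hb _ _).trans ?_
    rw [abs_of_nonneg (sub_nonneg.2 (Nat.floor_le hx))]
    linarith [Nat.lt_floor_add_one x]
  have h3 := h1.add h2
  rw [one_mul, add_zero] at h3
  refine h3.congr' ?_
  filter_upwards [eventually_ge_atTop 1] with x hx
  have hf : (⌊x⌋₊ : ℝ) ≠ 0 := by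
    have : 0 < ⌊x⌋₊ := Nat.floor_pos.2 hx
    positivity
  rw [← intervalIntegral.integral_add_adjacent_intervals
    (intervalIntegrable_of_abs_le_one hu hb 0 ⌊x⌋₊) (intervalIntegrable_of_abs_le_one hu hb ⌊x⌋₊ x)]
  simp only [Function.comp]
  field_simp

/-- Time averages of a bounded function forget a shift of the time origin. -/
theorem tendsto_timeAverage_shift (hu : Measurable u) (hb : ∀ y, |u y| ≤ 1) (z : ℝ) {l : ℝ}
    (h : Tendsto (fun x : ℝ => (1 / x) * ∫ y in (0 : ℝ)..x, u y) atTop (𝓝 l)) :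
    Tendsto (fun x : ℝ => (1 / x) * ∫ y in (0 : ℝ)..x, u (z + y)) atTop (𝓝 l) := by
  have h2 : Tendsto (fun x : ℝ => (1 / x) * ((∫ y in x..(z + x), u y) - ∫ y in (0 : ℝ)..z, u y))
      atTop (𝓝 0) := by
    refine tendsto_div_zero_of_abs_le (C := |z| + |z|) (Eventually.of_forall fun x => ?_)
    refine (abs_sub _ _).trans (add_le_add ?_ ?_)
    · simpa using abs_intervalIntegral_le hb x (z + x)
    · simpa using abs_intervalIntegral_le hb 0 z
  have h3 := h.add h2
  rw [add_zero] at h3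
  refine h3.congr fun x => ?_
  have hi := intervalIntegrable_of_abs_le_one hu hb
  rw [intervalIntegral.integral_comp_add_left, ← mul_add, add_zero]
  have e1 := intervalIntegral.integral_add_adjacent_intervals (hi 0 z) (hi z (z + x))
  have e2 := intervalIntegral.integral_add_adjacent_intervals (hi 0 x) (hi x (z + x))
  congr 1
  linarith

end TimeAverages

namespace PointProcess

/-- The time-shift as a self-map of `M^∞`. -/
noncomputable def flow (y : ℝ) (φ : Minf) : Minf := ⟨θ y φ.1, θ_mem_Minf φ.2 y⟩

theorem measurable_flow : Measurable fun p : ℝ × Minf => flow p.1 p.2 :=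
  (measurable_θ.comp (measurable_fst.prodMk
    (measurable_subtype_coe.comp measurable_snd))).subtype_mk

theorem measurable_flow_right (y : ℝ) : Measurable (flow y) :=
  measurable_flow.comp measurable_prodMk_left

theorem flow_flow (a b : ℝ) (φ : Minf) : flow a (flow b φ) = flow (b + a) φ :=
  Subtype.ext (θ_θ a b φ.1)

theorem flow_zero (φ : Minf) : flow 0 φ = φ := Subtype.ext (θ_zero φ.1)

theorem flow_one_iterate (n : ℕ) (φ : Minf) : (flow 1)^[n] φ = flow n φ := by
  induction n with
  | zero => simp [flow_zero]
  | succ n ih => rw [Function.iterate_succ_apply', ih, flow_flow, Nat.cast_succ]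

/-- The indicator of the event that the process shifted by `y` lies in `A`. -/
noncomputable def visit (A : Set Minf) (φ : Minf) (y : ℝ) : ℝ := A.indicator (fun _ => 1) (flow y φ)

section Flow

variable {A : Set Minf}

theorem measurable_visit (hA : MeasurableSet A) :
    Measurable fun p : ℝ × Minf => visit A p.2 p.1 :=
  (measurable_const.indicator hA).comp measurable_flow

theorem measurable_visit_left (hA : MeasurableSet A) (φ : Minf) : Measurable (visit A φ) :=
  (measurable_visit hA).comp measurable_prodMk_right

theorem visit_nonneg (A : Set Minf) (φ : Minf) (y : ℝ) : 0 ≤ visit A φ y :=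
  indicator_nonneg (fun _ _ => zero_le_one) _

theorem abs_visit_le (A : Set Minf) (φ : Minf) (y : ℝ) : |visit A φ y| ≤ 1 := by
  rw [abs_of_nonneg (visit_nonneg A φ y)]
  exact indicator_le_self' (fun _ _ => zero_le_one) _

theorem visit_flow (A : Set Minf) (φ : Minf) (z y : ℝ) : visit A (flow z φ) y = visit A φ (z + y) := by
  rw [visit, visit, flow_flow]

theorem measurable_integral_visit (hA : MeasurableSet A) {n : ℝ} (hn : 0 ≤ n) :
    Measurable fun φ => ∫ y in (0 : ℝ)..n, visit A φ y := by
  simp_rw [intervalIntegral.integral_of_le hn]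
  exact ((measurable_visit hA).comp measurable_swap).stronglyMeasurable.integral_prod_right.measurable

theorem abs_timeAverage_le {u : ℝ → ℝ} (hb : ∀ y, |u y| ≤ 1) (n : ℕ) :
    |(1 / (n : ℝ)) * ∫ y in (0 : ℝ)..n, u y| ≤ 1 := by
  have h := abs_intervalIntegral_le hb 0 n
  rw [sub_zero, Nat.abs_cast] at h
  rw [abs_mul, abs_of_nonneg (by positivity), one_div, inv_mul_eq_div]
  exact div_le_one_of_le₀ h (Nat.cast_nonneg n)

theorem birkhoffSum_integral_visit (hA : MeasurableSet A) (n : ℕ) (φ : Minf) :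
    birkhoffSum (flow 1) (fun ψ => ∫ y in (0 : ℝ)..1, visit A ψ y) n φ =
      ∫ y in (0 : ℝ)..n, visit A φ y := by
  induction n with
  | zero => simp
  | succ n ih =>
    have hi := intervalIntegrable_of_abs_le_one (measurable_visit_left hA φ) (abs_visit_le A φ)
    rw [birkhoffSum_succ, ih, flow_one_iterate]
    simp_rw [visit_flow]
    rw [intervalIntegral.integral_comp_add_left, add_zero,
      intervalIntegral.integral_add_adjacent_intervals (hi _ _) (hi _ _), Nat.cast_succ]

/-- `P` is asymptotically mean stationary under the flow of time-shifts, with limit `Q`. -/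
def IsFlowAMSWith (P Q : Measure Minf) : Prop :=
  ∀ A : Set Minf, MeasurableSet A →
    Tendsto (fun x : ℝ => (1 / x) * ∫ y in (0 : ℝ)..x, P.real (flow y ⁻¹' A)) atTop (𝓝 (Q.real A))

variable {P Q : Measure Minf}

theorem integral_visit (hA : MeasurableSet A) (y : ℝ) :
    ∫ φ, visit A φ y ∂P = P.real (flow y ⁻¹' A) := by
  have : (fun φ => visit A φ y) = (flow y ⁻¹' A).indicator 1 := rfl
  rw [this, integral_indicator_one (measurable_flow_right y hA)]

variable [IsProbabilityMeasure P]

theorem measurable_measureReal_flow (hA : MeasurableSet A) :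
    Measurable fun y => P.real (flow y ⁻¹' A) := by
  simp_rw [← integral_visit hA]
  exact (measurable_visit hA).stronglyMeasurable.integral_prod_right.measurable

theorem abs_measureReal_flow_le (A : Set Minf) (y : ℝ) : |P.real (flow y ⁻¹' A)| ≤ 1 := by
  rw [abs_of_nonneg measureReal_nonneg]
  exact measureReal_le_one

theorem integrable_visit (ν : Measure ℝ) [IsFiniteMeasure ν] (hA : MeasurableSet A) :
    Integrable (fun p : ℝ × Minf => visit A p.2 p.1) (ν.prod P) :=
  (integrable_const (1 : ℝ)).mono' (measurable_visit hA).aestronglyMeasurable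
    (ae_of_all _ fun p => abs_visit_le A p.2 p.1)

theorem integral_timeAverage_visit (hA : MeasurableSet A) (n : ℕ) :
    ∫ φ, (1 / (n : ℝ)) * (∫ y in (0 : ℝ)..n, visit A φ y) ∂P =
      (1 / (n : ℝ)) * ∫ y in (0 : ℝ)..n, P.real (flow y ⁻¹' A) := by
  rw [integral_const_mul]
  simp_rw [intervalIntegral.integral_of_le (Nat.cast_nonneg (α := ℝ) n), ← integral_visit hA]
  rw [integral_integral_swap]
  exact (integrable_visit (P := P) (volume.restrict (Ioc 0 (n : ℝ))) hA).swap

theorem IsFlowAMSWith.measurePreserving [IsProbabilityMeasure Q] (h : IsFlowAMSWith P Q) (z : ℝ) :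
    MeasurePreserving (flow z) Q Q := by
  refine ⟨measurable_flow_right z, Measure.ext fun A hA => ?_⟩
  have h1 := tendsto_timeAverage_shift (measurable_measureReal_flow (P := P) hA)
    (abs_measureReal_flow_le A) z (h A hA)
  have h3 : Q.real (flow z ⁻¹' A) = Q.real A := by
    refine tendsto_nhds_unique (h _ (measurable_flow_right z hA)) (h1.congr fun x => ?_)
    congr 1
    refine intervalIntegral.integral_congr fun y _ => ?_
    have : flow (z + y) ⁻¹' A = flow y ⁻¹' (flow z ⁻¹' A) := by
      ext φ
      simp only [mem_preimage, flow_flow, add_comm z y]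
    simp only [this]
  rw [Measure.map_apply (measurable_flow_right z) hA]
  exact (measureReal_eq_measureReal_iff).1 h3

theorem IsFlowAMSWith.ae_mem_iff [IsProbabilityMeasure Q] (h : IsFlowAMSWith P Q) {C : Set Minf}
    (hC : MeasurableSet C) (hinv : ∀ y, flow y ⁻¹' C = C) :
    (∀ᵐ φ ∂P, φ ∈ C) ↔ ∀ᵐ φ ∂Q, φ ∈ C := by
  have h1 : P.real Cᶜ = Q.real Cᶜ := by
    refine tendsto_nhds_unique (tendsto_const_nhds.congr' ?_) (h _ hC.compl)
    filter_upwards [eventually_gt_atTop 0] with x hx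
    simp only [preimage_compl, hinv, intervalIntegral.integral_const, sub_zero, smul_eq_mul]
    field_simp
  rw [ae_iff, ae_iff]
  change P Cᶜ = 0 ↔ Q Cᶜ = 0
  rw [← measureReal_eq_zero_iff, ← measureReal_eq_zero_iff (μ := Q), h1]

theorem exists_tendsto_timeAverage_flow (hA : MeasurableSet A) (z : ℝ) {φ : Minf}
    (h : ∃ l, Tendsto (fun x : ℝ => (1 / x) * ∫ y in (0 : ℝ)..x, visit A φ y) atTop (𝓝 l)) :
    ∃ l, Tendsto (fun x : ℝ => (1 / x) * ∫ y in (0 : ℝ)..x, visit A (flow z φ) y) atTop (𝓝 l) := by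
  obtain ⟨l, hl⟩ := h
  refine ⟨l, ?_⟩
  simp_rw [visit_flow]
  exact tendsto_timeAverage_shift (measurable_visit_left hA φ) (abs_visit_le A φ) z hl

/-- The analogue of `exists_isAMSWith_iff` for the flow of time-shifts. -/
theorem exists_isFlowAMSWith_iff :
    (∃ Q : Measure Minf, IsProbabilityMeasure Q ∧ IsFlowAMSWith P Q) ↔
      ∀ A : Set Minf, MeasurableSet A → ∀ᵐ φ ∂P, ∃ l : ℝ,
        Tendsto (fun x : ℝ => (1 / x) * ∫ y in (0 : ℝ)..x, visit A φ y) atTop (𝓝 l) := by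
  constructor
  · rintro ⟨Q, hQ, h⟩ A hA
    set C : Set Minf := {φ | ∃ l : ℝ,
      Tendsto (fun x : ℝ => (1 / x) * ∫ y in (0 : ℝ)..x, visit A φ y) atTop (𝓝 l)} with hCdef
    have hCnat : C = {φ | ∃ l : ℝ, Tendsto (fun n : ℕ =>
        (1 / (n : ℝ)) * ∫ y in (0 : ℝ)..n, visit A φ y) atTop (𝓝 l)} := by
      ext φ
      exact exists_congr fun l =>
        tendsto_timeAverage_iff_nat (measurable_visit_left hA φ) (abs_visit_le A φ) l
    have hC : MeasurableSet C := by
      rw [hCnat]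
      exact measurableSet_exists_tendsto fun n =>
        (measurable_integral_visit hA (Nat.cast_nonneg n)).const_mul _
    refine (h.ae_mem_iff hC fun z => ?_).2 ?_
    · ext φ
      refine ⟨fun hφ => ?_, exists_tendsto_timeAverage_flow hA z⟩
      have := exists_tendsto_timeAverage_flow hA (-z) hφ
      simp only [flow_flow, add_neg_cancel, flow_zero] at this
      exact this
    · rw [hCnat]
      have hg : Measurable fun φ => ∫ y in (0 : ℝ)..1, visit A φ y :=
        measurable_integral_visit hA zero_le_one
      have hgb : ∀ φ, ‖∫ y in (0 : ℝ)..1, visit A φ y‖ ≤ 1 := fun φ => by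
        simpa using abs_intervalIntegral_le (abs_visit_le A φ) 0 1
      filter_upwards [ae_exists_tendsto_birkhoffSum_div (h.measurePreserving 1) hg
        ((integrable_const (1 : ℝ)).mono' hg.aestronglyMeasurable (ae_of_all _ hgb))
        fun φ => intervalIntegral.integral_nonneg zero_le_one fun y _ => visit_nonneg A φ y]
        with φ ⟨l, hl⟩
      exact ⟨l, by simpa only [birkhoffSum_integral_visit hA] using hl⟩
  · intro h
    let ν : ℕ → Measure ℝ := fun n =>
      ((n + 1 : ℕ) : ℝ≥0∞)⁻¹ • volume.restrict (Ioc (0 : ℝ) (n + 1 : ℕ))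
    have hν : ∀ n, IsProbabilityMeasure (ν n) := fun n => ⟨by
      simp only [ν, Measure.smul_apply, Measure.restrict_apply_univ, Real.volume_Ioc, sub_zero,
        ENNReal.ofReal_natCast, smul_eq_mul]
      exact ENNReal.inv_mul_cancel (by simp) (ENNReal.natCast_ne_top _)⟩
    let μ : ℕ → Measure Minf := fun n => ((ν n).prod P).map fun p => flow p.1 p.2
    have hμ : ∀ n, IsProbabilityMeasure (μ n) := fun n =>
      Measure.isProbabilityMeasure_map measurable_flow.aemeasurable
    have hμA : ∀ n A, MeasurableSet A → (μ n).real A =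
        (1 / ((n + 1 : ℕ) : ℝ)) * ∫ y in (0 : ℝ)..(n + 1 : ℕ), P.real (flow y ⁻¹' A) := fun n A hA => by
      rw [← integral_indicator_one hA, integral_map measurable_flow.aemeasurable
        (measurable_one.indicator hA).aestronglyMeasurable]
      change ∫ p, visit A p.2 p.1 ∂((ν n).prod P) = _
      rw [integral_prod _ (integrable_visit (ν n) hA)]
      simp only [integral_visit hA]
      rw [integral_smul_measure, intervalIntegral.integral_of_le (Nat.cast_nonneg _), smul_eq_mul,
        ENNReal.toReal_inv, ENNReal.toReal_natCast, one_div]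
    obtain ⟨Q, hQ, hlim⟩ := exists_isProbabilityMeasure_of_tendsto μ fun A hA => by
      obtain ⟨l, hl⟩ := exists_tendsto_integral (P := P)
        (F := fun (n : ℕ) φ => (1 / (n : ℝ)) * ∫ y in (0 : ℝ)..n, visit A φ y)
        (fun n => (measurable_integral_visit hA (Nat.cast_nonneg n)).const_mul _)
        (fun n φ => abs_timeAverage_le (abs_visit_le A φ) n)
        ((h A hA).mono fun φ ⟨l, hl⟩ => ⟨l, hl.comp tendsto_natCast_atTop_atTop⟩)
      refine ⟨l, ((tendsto_add_atTop_iff_nat 1).2 hl).congr fun n => ?_⟩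
      rw [hμA n A hA, integral_timeAverage_visit hA]
    refine ⟨Q, hQ, fun A hA => ?_⟩
    rw [tendsto_timeAverage_iff_nat (measurable_measureReal_flow hA) (abs_measureReal_flow_le A),
      ← tendsto_add_atTop_iff_nat 1]
    exact (hlim A hA).congr fun n => hμA n A hA

end Flow

section TAMS

variable {P : Measure E} [IsProbabilityMeasure P]

theorem measureReal_θInv (hinf : P Minf = 1) (y : ℝ) (A : Set E) :
    P.real (θInv y A) = (toMinf P).real (flow y ⁻¹' (Subtype.val ⁻¹' A)) := by
  rw [← toMinf_real_preimage hinf]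
  rfl

theorem isTAMS_iff_flow (hinf : P Minf = 1) :
    IsTAMS P ↔ ∃ Q : Measure Minf, IsProbabilityMeasure Q ∧ IsFlowAMSWith (toMinf P) Q := by
  have := isProbabilityMeasure_toMinf hinf
  constructor
  · rintro ⟨Pts, hp, h⟩
    have hmp : IsProbabilityMeasure (Pts.map Subtype.val) :=
      Measure.isProbabilityMeasure_map measurable_subtype_coe.aemeasurable
    have hval : ∀ A : Set E, MeasurableSet A →
        (Pts.map Subtype.val).real A = Pts.real (Subtype.val ⁻¹' A) := fun A hA => by
      rw [measureReal_def, Measure.map_apply measurable_subtype_coe hA, measureReal_def]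
    -- `M^∞` is invariant under time-shifts, so the limit law lives on it.
    have hone : Pts.map Subtype.val Minf = 1 := by
      have h1 := h Minf measurableSet_Minf fun φ hφ => hφ.1
      have h2 : Pts.real (Subtype.val ⁻¹' Minf) = 1 := by
        refine tendsto_nhds_unique h1 (tendsto_const_nhds.congr' ?_)
        filter_upwards [eventually_gt_atTop 0] with x hx
        simp only [measureReal_θInv hinf, Subtype.coe_preimage_self, preimage_univ, probReal_univ,
          intervalIntegral.integral_const, sub_zero, smul_eq_mul]
        field_simp
      rw [← hval _ measurableSet_Minf, measureReal_def] at h2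
      rw [← ENNReal.ofReal_toReal (measure_ne_top (Pts.map Subtype.val) Minf), h2, ENNReal.ofReal_one]
    refine ⟨toMinf (Pts.map Subtype.val), isProbabilityMeasure_toMinf hone, ?_⟩
    rw [IsFlowAMSWith, ← forall_subset_Minf_iff]
    intro A hA hAsub
    rw [toMinf_real_preimage hone, hval A hA]
    simpa only [measureReal_θInv hinf] using h A hA fun φ hφ => (hAsub hφ).1
  · rintro ⟨Q, hQ, h⟩
    have hsub : Minf ⊆ M := fun φ hφ => hφ.1
    have hm : Measurable (inclusion hsub) := measurable_inclusion hsub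
    refine ⟨Q.map (inclusion hsub), Measure.isProbabilityMeasure_map hm.aemeasurable,
      fun A hA _ => ?_⟩
    have h1 := h (Subtype.val ⁻¹' A) (measurable_subtype_coe hA)
    have h2 : (Q.map (inclusion hsub)).real (Subtype.val ⁻¹' A) = Q.real (Subtype.val ⁻¹' A) := by
      rw [measureReal_def, Measure.map_apply hm (measurable_subtype_coe hA), measureReal_def]
      rfl
    rw [h2]
    simpa only [measureReal_θInv hinf] using h1

theorem isTAMS_iff (hinf : P Minf = 1) :
    IsTAMS P ↔ ∀ A : Set E, MeasurableSet A → A ⊆ Minf → ∀ᵐ φ ∂P, ∃ l : ℝ,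
      Tendsto (fun x : ℝ => (1 / x) *
        ∫ y in (0 : ℝ)..x, (θInv y A).indicator (fun _ => (1 : ℝ)) φ) atTop (𝓝 l) := by
  have := isProbabilityMeasure_toMinf hinf
  rw [isTAMS_iff_flow hinf, exists_isFlowAMSWith_iff, ← forall_subset_Minf_iff]
  refine forall_congr' fun A => forall_congr' fun _ => forall_congr' fun _ => ?_
  rw [ae_toMinf_iff hinf]
  rfl

end TAMS

end PointProcess

open PointProcess in
theorem theorem4p3 {Ω : Type*} [MeasurableSpace Ω] (ℙ : Measure Ω) [IsProbabilityMeasure ℙ]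
    (Φ : Ω → E) (hΦ : Measurable Φ) (P : Measure E) (hP : P = ℙ.map Φ) (hinf : P Minf = 1) :
    -- (a)
    (IsEAMS P ↔
      ∀ A : Set E, MeasurableSet A → A ⊆ Minf → ∀ᵐ φ ∂P, ∃ l : ℝ,
        Tendsto (fun n : ℕ => (1 / (n : ℝ)) *
          ∑ i ∈ Finset.Icc 1 n, (ηInv (i : ℤ) A).indicator (fun _ => (1 : ℝ)) φ) atTop (𝓝 l)) ∧
    -- (b)
    ((∃ Pes : Measure Minf, IsEAMSWith P Pes ∧
        ∀ᵐ φ ∂Pes, 0 < condMeanGap Pes φ ∧ condMeanGap Pes φ < ∞) ↔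
      (∀ A : Set E, MeasurableSet A → A ⊆ Minf → ∀ᵐ φ ∂P, ∃ l : ℝ,
        Tendsto (fun x : ℝ => (1 / x) * (NA A (Ioc 0 x) φ).toReal) atTop (𝓝 l)) ∧
      (∀ᵐ φ ∂P, ∃ l : ℝ, 0 < l ∧
        Tendsto (fun x : ℝ => (1 / x) * (N (Ioc 0 x) φ).toReal) atTop (𝓝 l))) ∧
    -- (c)
    (IsTAMS P ↔
      ∀ A : Set E, MeasurableSet A → A ⊆ Minf → ∀ᵐ φ ∂P, ∃ l : ℝ,
        Tendsto (fun x : ℝ => (1 / x) *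
          ∫ y in (0 : ℝ)..x, (θInv y A).indicator (fun _ => (1 : ℝ)) φ) atTop (𝓝 l)) := by
  have hP' : IsProbabilityMeasure P := hP ▸ Measure.isProbabilityMeasure_map hΦ.aemeasurable
  exact ⟨isEAMS_iff hinf, isEAMS_condMeanGap_iff hinf, isTAMS_iff hinf⟩
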